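/- A binary linear code is a subspace $C$ of $\mathrm{GF}(2)^n$; its rate is $\dim(C)/n$. For $p\in(0,\frac12)$, transmit a codeword $c\in C$ over the binary symmetric channel with bit-error rate $p$ (each entry is switched independently with probability $p$). A maximum-likelihood decoding error occurs when $c$ is not the unique codeword of $C$ that is most likely to have been sent, given the received word; the probability of this event does not depend on $c$. For a class $\mathcal{C}$ of binary linear codes and $R\in(0,1)$, the maximum-likelihood decoding threshold $\theta_{\mathcal{C}}(R)$ is the unique $\theta\in[0,\frac12]$ such that (i) for each $p\in(0,\theta)$ and each $\varepsilon>0$ there is a code $C\in\mathcal{C}$ of rate at least $R$ whose probability of a maximum-likelihood decoding error over the binary symmetric channel with bit-error rate $p$ is at most $\varepsilon$, and (ii) for each $p\in(\theta,\frac12)$ there is an $\varepsilon>0$ such that every code $C\in\mathcal{C}$ of rate at least $R$ has probability of a maximum-likelihood decoding error at least $\varepsilon$ over the binary symmetric channel with bit-error rate $p$. The cycle code of a finite graph $G=(V,E)$ (loops and parallel edges are allowed) is the subspace of $\mathrm{GF}(2)^E$ that consists of the characteristic vectors of the edge sets of even subgraphs of $G$, that is, of subgraphs in which every vertex has even degree.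 Let $\mathcal{G}$ be the class of cycle codes of finite graphs. **Theorem.** For every $R\in(0,1)$, $$\theta_{\mathcal{G}}(R)\le\frac{(1-\sqrt R)^2}{2(1+R)}.$$ If equality holds, then $R=1-\frac2d$ for some $d\in\mathbb{Z}$. -/

import Mathlib

/-- A binary linear code of length `length`: a subspace of `GF(2)^length`. -/
structure BinaryCode where
  /-- the length of the code -/
  length : ℕ
  /-- the set of codewords -/
  words : Submodule (ZMod 2) (Fin length → ZMod 2)

namespace BinaryCode

/-- The rate `k / n` of an `[n, k]`-code (the value for `n = 0` is `0`). -/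
noncomputable def rate (C : BinaryCode) : ℝ :=
  (Module.finrank (ZMod 2) C.words : ℝ) / (C.length : ℝ)

/-- The binary symmetric channel with bit-error rate `p`: the probability that the word `x` is
received when the word `c` is sent. -/
noncomputable def bscProb (p : ℝ) {n : ℕ} (c x : Fin n → ZMod 2) : ℝ :=
  ∏ i, if x i = c i then 1 - p else p

/-- When `x` is received, `c` is the unique most likely codeword of `C` to have been sent. -/
def IsMLDecoding (p : ℝ) (C : BinaryCode) (x c : Fin C.length → ZMod 2) : Prop :=
  c ∈ C.words ∧ ∀ c' ∈ C.words, c' ≠ c → bscProb p c' x < bscProb p c x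

open Classical in
/-- The probability of a decoding error when the codeword `c` of `C` is sent: the maximum-likelihood
choice is ambiguous or differs from `c`. -/
noncomputable def mlErrorProbAt (p : ℝ) (C : BinaryCode) (c : Fin C.length → ZMod 2) : ℝ :=
  ∑ x, if IsMLDecoding p C x c then 0 else bscProb p c x

/-- The probability of a maximum-likelihood decoding error in the code `C`. It does not depend on
the codeword that is sent (`mlErrorProb_eq_mlErrorProbAt`), so `0` is used. -/
noncomputable def mlErrorProb (p : ℝ) (C : BinaryCode) : ℝ := mlErrorProbAt p C 0

theorem bscProb_add (p : ℝ) {n : ℕ} (c x d : Fin n → ZMod 2) :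
    bscProb p (c + d) (x + d) = bscProb p c x := by
  simp [bscProb]

theorem isMLDecoding_add (p : ℝ) (C : BinaryCode) {c : Fin C.length → ZMod 2} (hc : c ∈ C.words)
    (x : Fin C.length → ZMod 2) : IsMLDecoding p C (x + c) c ↔ IsMLDecoding p C x 0 := by
  constructor
  · rintro ⟨_, h⟩
    refine ⟨C.words.zero_mem, fun c' hc' hne => ?_⟩
    have := h (c' + c) (C.words.add_mem hc' hc) (by simpa using hne)
    rw [bscProb_add] at this
    rw [← bscProb_add p 0 x c]
    simpa using this
  · rintro ⟨_, h⟩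
    refine ⟨hc, fun c' hc' hne => ?_⟩
    have := h (c' - c) (C.words.sub_mem hc' hc) (by simpa [sub_eq_zero] using hne)
    rw [← bscProb_add p (c' - c) x c, ← bscProb_add p 0 x c] at this
    simpa using this

theorem mlErrorProb_eq_mlErrorProbAt (p : ℝ) (C : BinaryCode) {c : Fin C.length → ZMod 2}
    (hc : c ∈ C.words) : mlErrorProb p C = mlErrorProbAt p C c := by
  classical
  unfold mlErrorProb mlErrorProbAt
  refine Fintype.sum_equiv (Equiv.addRight c) _ _ fun x => ?_
  have h1 := isMLDecoding_add p C hc x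
  have h2 := bscProb_add p 0 x c
  simp only [zero_add] at h2
  simp only [Equiv.coe_addRight, h1, h2]

theorem bscProb_eq (p : ℝ) {n : ℕ} (c x : Fin n → ZMod 2) :
    bscProb p c x = p ^ hammingDist c x * (1 - p) ^ (n - hammingDist c x) := by
  classical
  have h : ∀ i, (if x i = c i then 1 - p else p) = (if c i ≠ x i then p else 1 - p) := by
    intro i
    by_cases hi : x i = c i
    · simp [hi]
    · rw [if_neg hi, if_pos (Ne.symm hi)]
  have hcard : (Finset.univ.filter fun i => ¬ c i ≠ x i).card = n - hammingDist c x := by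
    have h2 := Finset.card_filter_add_card_filter_not (s := (Finset.univ : Finset (Fin n)))
      (fun i => c i ≠ x i)
    simp only [Finset.card_univ, Fintype.card_fin] at h2
    unfold hammingDist
    omega
  unfold bscProb
  rw [Finset.prod_congr rfl (fun i _ => h i), Finset.prod_ite, Finset.prod_const,
    Finset.prod_const, hcard]
  rfl

theorem bscProb_lt_iff {p : ℝ} (h0 : 0 < p) (h1 : p < 1 / 2) {n : ℕ} (c d x : Fin n → ZMod 2) :
    bscProb p c x < bscProb p d x ↔ hammingDist d x < hammingDist c x := by
  have key : ∀ a b : ℕ, a < b → b ≤ n →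
      p ^ b * (1 - p) ^ (n - b) < p ^ a * (1 - p) ^ (n - a) := by
    intro a b hab hbn
    obtain ⟨k, rfl⟩ := Nat.exists_eq_add_of_lt hab
    have e : n - a = (n - (a + k + 1)) + (k + 1) := by omega
    rw [e, add_assoc a k 1, pow_add p, pow_add (1 - p)]
    have hlt : p ^ (k + 1) < (1 - p) ^ (k + 1) :=
      pow_lt_pow_left₀ (by linarith) h0.le (Nat.succ_ne_zero k)
    have hp : 0 < p ^ a := pow_pos h0 a
    have hq : 0 < (1 - p) ^ (n - (a + (k + 1))) := pow_pos (by linarith) _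
    nlinarith [mul_lt_mul_of_pos_left hlt (mul_pos hp hq)]
  have hle : ∀ c : Fin n → ZMod 2, hammingDist c x ≤ n := fun c => by
    simpa using hammingDist_le_card_fintype (x := c) (y := x)
  rw [bscProb_eq, bscProb_eq]
  constructor
  · intro h
    by_contra! hcon
    rcases hcon.eq_or_lt with he | hl
    · rw [he] at h
      exact lt_irrefl _ h
    · exact lt_asymm h (key _ _ hl (hle d))
  · intro h
    exact key _ _ h (hle c)

theorem bscProb_nonneg {p : ℝ} (h0 : 0 ≤ p) (h1 : p ≤ 1) {n : ℕ} (c x : Fin n → ZMod 2) :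
    0 ≤ bscProb p c x := by
  refine Finset.prod_nonneg fun i _ => ?_
  split_ifs <;> linarith

theorem sum_bscProb_succ (p : ℝ) {n : ℕ} (f : (Fin (n + 1) → ZMod 2) → ℝ) :
    ∑ x, f x * bscProb p 0 x =
      (1 - p) * ∑ x : Fin n → ZMod 2, f (Fin.cons 0 x) * bscProb p 0 x +
        p * ∑ x : Fin n → ZMod 2, f (Fin.cons 1 x) * bscProb p 0 x := by
  rw [← (Fin.consEquiv fun _ : Fin (n + 1) => ZMod 2).sum_comp, Fintype.sum_prod_type]
  have h2 : ∀ g : ZMod 2 → ℝ, ∑ a, g a = g 0 + g 1 := fun g => Fin.sum_univ_two g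
  rw [h2, Finset.mul_sum, Finset.mul_sum]
  congr 1 <;>
  · refine Finset.sum_congr rfl fun x _ => ?_
    simp [bscProb, Fin.prod_univ_succ, Fin.consEquiv]
    ring

theorem sum_bscProb_mono {p q : ℝ} (h0 : 0 ≤ p) (hpq : p ≤ q) (h1 : q ≤ 1) :
    ∀ {n : ℕ} (f : (Fin n → ZMod 2) → ℝ)
      (_ : ∀ x y, (∀ i, x i = 0 ∨ y i = x i) → f x ≤ f y),
      ∑ x, f x * bscProb p 0 x ≤ ∑ x, f x * bscProb q 0 x := by
  intro n
  induction n with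
  | zero => intro f _; simp [bscProb]
  | succ n ih =>
    intro f hf
    rw [sum_bscProb_succ, sum_bscProb_succ]
    have hcons : ∀ a : ZMod 2, ∀ x y : Fin n → ZMod 2, (∀ i, x i = 0 ∨ y i = x i) →
        f (Fin.cons a x) ≤ f (Fin.cons a y) := fun a x y h =>
      hf _ _ fun i => by
        refine Fin.cases ?_ (fun j => ?_) i
        · simp
        · simpa using h j
    have i0 := ih (fun x => f (Fin.cons 0 x)) (hcons 0)
    have i1 := ih (fun x => f (Fin.cons 1 x)) (hcons 1)
    have i2 : ∑ x : Fin n → ZMod 2, f (Fin.cons 0 x) * bscProb p 0 x ≤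
        ∑ x : Fin n → ZMod 2, f (Fin.cons 1 x) * bscProb p 0 x := by
      refine Finset.sum_le_sum fun x _ =>
        mul_le_mul_of_nonneg_right (hf _ _ fun i => ?_) (bscProb_nonneg h0 (by linarith) _ _)
      refine Fin.cases ?_ (fun j => ?_) i <;> simp
    have j0 := mul_le_mul_of_nonneg_left i0 (by linarith : (0 : ℝ) ≤ 1 - q)
    have j1 := mul_le_mul_of_nonneg_left i1 (by linarith : (0 : ℝ) ≤ q)
    have j2 := mul_le_mul_of_nonneg_left i2 (by linarith : (0 : ℝ) ≤ q - p)
    nlinarith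

theorem hammingDist_zero_le {n : ℕ} (c x y : Fin n → ZMod 2) (hxy : ∀ i, x i = 0 ∨ y i = x i)
    (h : hammingDist c x ≤ hammingDist 0 x) : hammingDist c y ≤ hammingDist 0 y := by
  classical
  have e : hammingDist 0 y = hammingDist 0 x + hammingDist x y := by
    unfold hammingDist
    rw [← Finset.card_union_of_disjoint]
    · congr 1
      ext i
      have := hxy i
      simp only [Finset.mem_filter, Finset.mem_univ, true_and, Finset.mem_union, Pi.zero_apply]
      grind
    · rw [Finset.disjoint_filter]
      intro i _ hi
      have := hxy i
      simp only [Pi.zero_apply] at hi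
      grind
  have := hammingDist_triangle c x y
  omega

theorem mlErrorProb_mono {p q : ℝ} (h0 : 0 < p) (hpq : p ≤ q) (h1 : q < 1 / 2)
    (C : BinaryCode) : mlErrorProb p C ≤ mlErrorProb q C := by
  classical
  set f : (Fin C.length → ZMod 2) → ℝ := fun x =>
    if ∃ c ∈ C.words, c ≠ 0 ∧ hammingDist c x ≤ hammingDist 0 x then 1 else 0 with hfdef
  have key : ∀ r : ℝ, 0 < r → r < 1 / 2 → mlErrorProb r C = ∑ x, f x * bscProb r 0 x := by
    intro r hr0 hr1
    refine Finset.sum_congr rfl fun x _ => ?_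
    have : IsMLDecoding r C x 0 ↔
        ¬ ∃ c ∈ C.words, c ≠ 0 ∧ hammingDist c x ≤ hammingDist 0 x := by
      simp only [IsMLDecoding, bscProb_lt_iff hr0 hr1, C.words.zero_mem, true_and]
      push Not
      rfl
    by_cases h : ∃ c ∈ C.words, c ≠ 0 ∧ hammingDist c x ≤ hammingDist 0 x
    · rw [if_neg (by rw [this]; exact not_not.2 h)]
      simp only [hfdef]
      rw [if_pos h, one_mul]
    · rw [if_pos (this.2 h)]
      simp only [hfdef]
      rw [if_neg h, zero_mul]
  rw [key p h0 (by linarith), key q (by linarith) h1]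
  refine sum_bscProb_mono h0.le hpq (by linarith) f fun x y hxy => ?_
  simp only [hfdef]
  split_ifs with hx hy
  · exact le_rfl
  · obtain ⟨c, hc, hne, hle⟩ := hx
    exact absurd ⟨c, hc, hne, hammingDist_zero_le c x y hxy hle⟩ hy
  · exact zero_le_one
  · exact le_rfl

/-- `θ` is a maximum-likelihood decoding threshold of the class `𝒞` of codes at the rate `R`. -/
def IsMLThreshold (𝒞 : Set BinaryCode) (R θ : ℝ) : Prop :=
  θ ∈ Set.Icc (0 : ℝ) (1 / 2) ∧
  (∀ p ∈ Set.Ioo 0 θ, ∀ ε > 0, ∃ C ∈ 𝒞, R ≤ C.rate ∧ mlErrorProb p C ≤ ε) ∧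
  (∀ p ∈ Set.Ioo θ (1 / 2), ∃ ε > 0, ∀ C ∈ 𝒞, R ≤ C.rate → ε ≤ mlErrorProb p C)

/-- Every class of codes has exactly one threshold at every rate. -/
theorem existsUnique_isMLThreshold (𝒞 : Set BinaryCode) (R : ℝ) :
    ∃! θ, IsMLThreshold 𝒞 R θ := by
  set S : Set ℝ := {p | p = 0 ∨ (p ∈ Set.Ioo (0 : ℝ) (1 / 2) ∧
    ∀ ε > 0, ∃ C ∈ 𝒞, R ≤ C.rate ∧ mlErrorProb p C ≤ ε)} with hS
  have hub : ∀ p ∈ S, p ≤ 1 / 2 := by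
    rintro p (rfl | ⟨hp, _⟩)
    · norm_num
    · exact hp.2.le
  have hbdd : BddAbove S := ⟨1 / 2, hub⟩
  have hzero : (0 : ℝ) ∈ S := Or.inl rfl
  have uniq : ∀ a b, IsMLThreshold 𝒞 R a → IsMLThreshold 𝒞 R b → ¬ a < b := by
    intro a b ha hb hab
    obtain ⟨p, hap, hpb⟩ := exists_between hab
    obtain ⟨ε, hε, h⟩ := ha.2.2 p ⟨hap, hpb.trans_le hb.1.2⟩
    obtain ⟨C, hC, hR, hle⟩ := hb.2.1 p ⟨ha.1.1.trans_lt hap, hpb⟩ (ε / 2) (half_pos hε)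
    linarith [h C hC hR]
  have hsup : IsMLThreshold 𝒞 R (sSup S) := by
    refine ⟨⟨le_csSup hbdd hzero, csSup_le ⟨0, hzero⟩ hub⟩, ?_, ?_⟩
    · rintro p ⟨hp0, hp1⟩ ε hε
      obtain ⟨q, hq, hpq⟩ := exists_lt_of_lt_csSup ⟨0, hzero⟩ hp1
      rcases hq with rfl | ⟨hq, h⟩
      · exact absurd hpq (not_lt.2 hp0.le)
      · obtain ⟨C, hC, hR, hle⟩ := h ε hε
        exact ⟨C, hC, hR, (mlErrorProb_mono hp0 hpq.le hq.2 C).trans hle⟩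
    · rintro p ⟨hp0, hp1⟩
      by_contra! hcon
      have hpos : 0 < p := (le_csSup hbdd hzero).trans_lt hp0
      refine absurd (le_csSup hbdd (Or.inr ⟨⟨hpos, hp1⟩, fun ε hε => ?_⟩)) (not_le.2 hp0)
      obtain ⟨C, hC, hR, h⟩ := hcon ε hε
      exact ⟨C, hC, hR, h.le⟩
  exact ⟨sSup S, hsup, fun θ hθ =>
    le_antisymm (not_lt.1 (uniq _ _ hsup hθ)) (not_lt.1 (uniq _ _ hθ hsup))⟩

/-- The maximum-likelihood decoding threshold of the class `𝒞` at `R`: the unique real number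
`θ` with `IsMLThreshold 𝒞 R θ`. -/
noncomputable def mlThreshold (𝒞 : Set BinaryCode) (R : ℝ) : ℝ :=
  (existsUnique_isMLThreshold 𝒞 R).choose

theorem isMLThreshold_mlThreshold (𝒞 : Set BinaryCode) (R : ℝ) :
    IsMLThreshold 𝒞 R (mlThreshold 𝒞 R) :=
  (existsUnique_isMLThreshold 𝒞 R).choose_spec.1

open Classical in
/-- The degree of the vertex `v` in the subgraph with edge set `F` of a multigraph `G`; a loop
counts twice. -/
noncomputable def degreeIn {V : Type} {n : ℕ} (G : Graph V (Fin n)) (F : Finset (Fin n))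
    (v : V) : ℕ :=
  (F.filter fun e => G.IsNonloopAt e v).card + 2 * (F.filter fun e => G.IsLoopAt e v).card

/-- `F` is the edge set of an even subgraph of `G`, that is, a cycle of `G`. -/
def IsEvenEdgeSet {V : Type} {n : ℕ} (G : Graph V (Fin n)) (F : Finset (Fin n)) : Prop :=
  (∀ e ∈ F, e ∈ G.edgeSet) ∧ ∀ v ∈ G.vertexSet, Even (degreeIn G F v)

/-- The set of coordinates at which a binary word equals `1`. -/
def wordSupport {n : ℕ} (x : Fin n → ZMod 2) : Finset (Fin n) :=
  Finset.univ.filter fun e => x e = 1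

open Classical in
theorem even_degreeIn_wordSupport {V : Type} {n : ℕ} (G : Graph V (Fin n))
    (x : Fin n → ZMod 2) (v : V) :
    Even (degreeIn G (wordSupport x) v) ↔ ∑ e with G.IsNonloopAt e v, x e = 0 := by
  have h : ∑ e with G.IsNonloopAt e v, x e =
      (((wordSupport x).filter fun e => G.IsNonloopAt e v).card : ZMod 2) := by
    rw [Finset.card_filter, wordSupport, Finset.sum_filter, Finset.sum_filter, Nat.cast_sum]
    refine Finset.sum_congr rfl fun e _ => ?_
    have h2 : ∀ a : ZMod 2, a = if a = 1 then 1 else 0 := by decide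
    conv_lhs => rw [h2 (x e)]
    split_ifs <;> simp
  rw [h, ZMod.natCast_eq_zero_iff_even, degreeIn, Nat.even_add]
  simp

/-- The cycle code of a multigraph `G` whose edges are labelled by coordinates: the words that are
characteristic vectors of cycles of `G`. -/
def cycleSpace {V : Type} {n : ℕ} (G : Graph V (Fin n)) :
    Submodule (ZMod 2) (Fin n → ZMod 2) where
  carrier := {x | IsEvenEdgeSet G (wordSupport x)}
  zero_mem' := ⟨by simp [wordSupport], fun v _ => by
    rw [even_degreeIn_wordSupport]; simp⟩
  add_mem' := by
    rintro x y ⟨hx, hx'⟩ ⟨hy, hy'⟩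
    refine ⟨fun e he => ?_, fun v hv => ?_⟩
    · have h2 : ∀ a b : ZMod 2, a + b = 1 → a = 1 ∨ b = 1 := by decide
      simp only [wordSupport, Finset.mem_filter, Finset.mem_univ, true_and, Pi.add_apply]
        at he hx hy
      exact (h2 _ _ he).elim (hx e) (hy e)
    · have h1 := hx' v hv
      have h2 := hy' v hv
      rw [even_degreeIn_wordSupport] at h1 h2 ⊢
      simp [Finset.sum_add_distrib, h1, h2]
  smul_mem' := by
    rintro a x ⟨hx, hx'⟩
    refine ⟨fun e he => ?_, fun v hv => ?_⟩
    · have h2 : ∀ a b : ZMod 2, a * b = 1 → b = 1 := by decide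
      simp only [wordSupport, Finset.mem_filter, Finset.mem_univ, true_and, Pi.smul_apply,
        smul_eq_mul] at he hx
      exact hx e (h2 _ _ he)
    · have h1 := hx' v hv
      rw [even_degreeIn_wordSupport] at h1 ⊢
      simp [← Finset.mul_sum, h1]

/-- The class of cycle codes of finite graphs (loops and parallel edges are allowed). -/
def cycleCodes : Set BinaryCode :=
  {C | ∃ (V : Type) (_ : Finite V) (G : Graph V (Fin C.length)),
    G.edgeSet = Set.univ ∧ C.words = cycleSpace G}

end BinaryCode

/-! ### Undecodable words and conditioning on received bits -/

namespace BinaryCode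

/-! Let `p` exceed the bound and take a graph whose cycle code has rate at least `R`. If it has a
cycle of length below a constant `g`, all edges of that cycle are in error with probability at least
`p ^ g` (`pow_le_sum_undecodable`). Otherwise one explores, from a suitable dart, the
non-backtracking walks on which every block of `T` bits has more errors than correct bits. A block
succeeds with probability about `(4 * p * (1 - p)) ^ (T / 2)`, so this branching process is
supercritical if `4 * p * (1 - p) * l ^ 2 > 1`, where `l` is the growth rate of non-backtracking
walks (`exists_one_le_tailWeight`, `blockPotential`). The graph is finite, so a surviving
exploration must run into a vertex already reached. This closes a long cycle with at least as many
errors as correct bits, and the word is undecodable (`undecodable_of_collision`, `le_errorProb`).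

To bound `l`, pass to a minimal nonempty edge set of rate at least `R`. It has minimum degree at
least two and is connected, so its average degree is at least about `x₀ = 2 / (1 - R)`. By Jensen's
inequality `l` can be taken to be the geometric mean of `deg - 1` over the darts
(`exists_superharmonic_darts`). The function `x * log (x - 1)` is convex for `x ≥ 2`; its tangent at
`x₀` yields `l` arbitrarily close to `x₀ - 1 = (1 + R) / (1 - R)`, and the bound `P` of the theorem
solves `4 * P * (1 - P) * (x₀ - 1) ^ 2 = 1`.

Degrees are integers. Unless `x₀` is an integer `d`, that is, `R = 1 - 2 / d`, the tangent can be
raised without crossing the graph at an integer; then the walks grow strictly faster and the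
threshold is strictly below `P`. -/

/-- A word is undecodable for the sent word `0` if another codeword is at least as close to it. -/
def Undecodable {n : ℕ} (C : Submodule (ZMod 2) (Fin n → ZMod 2)) (x : Fin n → ZMod 2) : Prop :=
  ∃ c ∈ C, c ≠ 0 ∧ hammingDist c x ≤ hammingDist 0 x

open Classical in
theorem mlErrorProb_eq_sum {p : ℝ} (h0 : 0 < p) (h1 : p < 1 / 2) (C : BinaryCode) :
    mlErrorProb p C =
      ∑ x, (if Undecodable C.words x then (1 : ℝ) else 0) * bscProb p 0 x := by
  refine Finset.sum_congr rfl fun x _ => ?_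
  have : IsMLDecoding p C x 0 ↔ ¬ Undecodable C.words x := by
    simp only [IsMLDecoding, bscProb_lt_iff h0 h1, C.words.zero_mem, true_and, Undecodable]
    push Not
    rfl
  by_cases h : Undecodable C.words x
  · rw [if_neg (by rw [this]; exact not_not.2 h), if_pos h, one_mul]
  · rw [if_pos (this.2 h), if_neg h, zero_mul]

/-- Conditioning on one bit. The sums on the right still run over all words, with the bit
overwritten, so that the identity can be iterated as further bits are revealed. -/
theorem sum_bscProb_update (p : ℝ) {n : ℕ} (f : (Fin n → ZMod 2) → ℝ) (c : Fin n) :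
    ∑ x, f x * bscProb p 0 x =
      (1 - p) * ∑ x, f (Function.update x c 0) * bscProb p 0 x +
        p * ∑ x, f (Function.update x c 1) * bscProb p 0 x := by
  set S := (Equiv.funSplitAt c (ZMod 2)).symm with hS
  have hupd : ∀ a b y, Function.update (S (a, y)) c b = S (b, y) := by
    intro a b y
    ext j
    by_cases hj : j = c <;> simp [hS, Equiv.funSplitAt, Equiv.piSplitAt, hj]
  have h2 : ∀ g : ZMod 2 → ℝ, ∑ a, g a = g 0 + g 1 := fun g => Fin.sum_univ_two g
  have hprob : ∀ a y, bscProb p 0 (S (a, y)) = (if a = 0 then 1 - p else p) *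
      ∏ j : {j // j ≠ c}, if y j = 0 then 1 - p else p := by
    intro a y
    unfold bscProb
    rw [Fintype.prod_eq_mul_prod_subtype_ne _ c]
    congr 1
    · simp [hS, Equiv.funSplitAt, Equiv.piSplitAt]
    · refine Finset.prod_congr rfl fun j _ => ?_
      simp [hS, Equiv.funSplitAt, Equiv.piSplitAt, j.2]
  have key : ∀ h : (Fin n → ZMod 2) → ℝ, ∑ x, h x * bscProb p 0 x =
      ∑ y : {j // j ≠ c} → ZMod 2, ((1 - p) * h (S (0, y)) + p * h (S (1, y))) *
        ∏ j, if y j = 0 then 1 - p else p := by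
    intro h
    rw [← S.sum_comp, Fintype.sum_prod_type, h2, ← Finset.sum_add_distrib]
    refine Finset.sum_congr rfl fun y _ => ?_
    rw [hprob, hprob]
    simp only [if_true, one_ne_zero, if_false]
    ring
  rw [key f, key fun x => f (Function.update x c 0), key fun x => f (Function.update x c 1),
    Finset.mul_sum, Finset.mul_sum, ← Finset.sum_add_distrib]
  refine Finset.sum_congr rfl fun y _ => ?_
  simp only [hupd]
  ring

theorem sum_bscProb (p : ℝ) (n : ℕ) : ∑ x : Fin n → ZMod 2, bscProb p 0 x = 1 := by
  induction n with
  | zero => simp [bscProb]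
  | succ n ih =>
    have := sum_bscProb_succ p (n := n) (fun _ => 1)
    simp only [one_mul, ih] at this
    rw [this]; ring

/-- The contribution of a coordinate of the received word: `1` for an error, `-1` otherwise. -/
def errorSign (a : ZMod 2) : ℤ := if a = 0 then -1 else 1

/-- On the support of `c`, each error shifts the comparison of distances by one in favour of `c`,
and each correct bit by one in favour of `0`. -/
theorem undecodable_of_sum_errorSign {n : ℕ} {C : Submodule (ZMod 2) (Fin n → ZMod 2)}
    {c x : Fin n → ZMod 2} (hc : c ∈ C) (h0 : c ≠ 0)
    (h : 0 ≤ ∑ e, if c e = 0 then 0 else errorSign (x e)) : Undecodable C x := by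
  refine ⟨c, hc, h0, ?_⟩
  have key : ((hammingDist 0 x : ℕ) : ℤ) - hammingDist c x =
      ∑ e, if c e = 0 then 0 else errorSign (x e) := by
    simp only [hammingDist, Finset.card_filter, Nat.cast_sum, ← Finset.sum_sub_distrib]
    refine Finset.sum_congr rfl fun e _ => ?_
    have : ∀ a b : ZMod 2, (((if (0 : ZMod 2) ≠ b then 1 else 0 : ℕ) : ℤ) -
        ((if a ≠ b then 1 else 0 : ℕ) : ℤ)) = if a = 0 then 0 else errorSign b := by
      unfold errorSign; decide
    exact this _ _
  omega

/-! ### Potentials for paths with many errors -/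

/-- A potential for the survival of a path along which the errors are counted by an automaton with
states `σ`: the potential `u` of a live state is at most `γ` times its mean after one step, and
`height` is dominated by the sum of `errorSign - α` along the path. -/
structure SurvivalPotential (σ : Type) (p γ α K U : ℝ) where
  /-- the transition on reading an error (`1`) or a correct bit (`0`) -/
  step : σ → ZMod 2 → σ
  /-- the potential of a state, positive for live states -/
  u : σ → ℝ
  /-- a lower bound for the drift collected by the state -/
  height : σ → ℝ
  /-- the reachable states -/
  valid : σ → Prop
  u_nonneg : ∀ s, 0 ≤ u s
  u_le : ∀ s, valid s → u s ≤ U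
  abs_height_le : ∀ s, valid s → |height s| ≤ K
  valid_step : ∀ s a, valid s → 0 < u s → valid (step s a)
  height_step : ∀ s a, valid s → 0 < u s →
    height (step s a) ≤ height s + (errorSign a - α)
  u_step : ∀ s, valid s → 0 < u s → u s ≤ γ * ((1 - p) * u (step s 0) + p * u (step s 1))

/-- The probability that `j` further bits carry weight at least `r`, times `γ ^ j`. -/
noncomputable def tailWeight (p γ : ℝ) : ℕ → ℤ → ℝ
  | 0, r => if r ≤ 0 then 1 else 0
  | j + 1, r => γ * ((1 - p) * tailWeight p γ j (r + 1) + p * tailWeight p γ j (r - 1))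

section
variable {p γ : ℝ}

theorem tailWeight_nonneg (h0 : 0 ≤ p) (h1 : p ≤ 1) (hγ : 0 ≤ γ) :
    ∀ j r, 0 ≤ tailWeight p γ j r
  | 0, r => by unfold tailWeight; split_ifs <;> norm_num
  | j + 1, r => by
    unfold tailWeight
    have a := tailWeight_nonneg h0 h1 hγ j (r + 1)
    have b := tailWeight_nonneg h0 h1 hγ j (r - 1)
    have : 0 ≤ 1 - p := by linarith
    positivity

theorem tailWeight_le (h0 : 0 ≤ p) (h1 : p ≤ 1) (hγ : 0 ≤ γ) :
    ∀ j r, tailWeight p γ j r ≤ γ ^ j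
  | 0, r => by unfold tailWeight; split_ifs <;> norm_num
  | j + 1, r => by
    unfold tailWeight
    have a := tailWeight_le h0 h1 hγ j (r + 1)
    have b := tailWeight_le h0 h1 hγ j (r - 1)
    rw [pow_succ']
    refine mul_le_mul_of_nonneg_left ?_ hγ
    nlinarith

/-- Exactly `i` errors among `j` bits carry weight `2 * i - j`. This event is split by its first
bit, as in Pascal's rule. -/
theorem le_tailWeight (h0 : 0 ≤ p) (h1 : p ≤ 1) (hγ : 0 ≤ γ) :
    ∀ (j i : ℕ) (r : ℤ), r ≤ 2 * i - j → i ≤ j →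
      γ ^ j * (j.choose i * p ^ i * (1 - p) ^ (j - i)) ≤ tailWeight p γ j r
  | 0, i, r, hr, hi => by
    obtain rfl : i = 0 := by omega
    unfold tailWeight
    rw [if_pos (by simpa using hr)]
    simp
  | j + 1, i, r, hr, hi => by
    have hq : 0 ≤ 1 - p := by linarith
    unfold tailWeight
    rw [pow_succ', mul_assoc]
    refine mul_le_mul_of_nonneg_left ?_ hγ
    have hA : γ ^ j * (j.choose i * p ^ i * (1 - p) ^ (j + 1 - i)) ≤
        (1 - p) * tailWeight p γ j (r + 1) := by
      rcases hi.eq_or_lt with rfl | hlt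
      · rw [Nat.choose_succ_self]
        have := tailWeight_nonneg h0 h1 hγ j (r + 1)
        simp only [Nat.cast_zero, zero_mul, mul_zero]
        positivity
      · have := le_tailWeight h0 h1 hγ j i (r + 1) (by push_cast at hr ⊢; omega) (by omega)
        rw [show j + 1 - i = (j - i) + 1 by omega, pow_succ]
        have := mul_le_mul_of_nonneg_left this hq
        linarith
    rcases Nat.eq_zero_or_pos i with rfl | hpos
    · have := tailWeight_nonneg h0 h1 hγ j (r - 1)
      have : 0 ≤ p * tailWeight p γ j (r - 1) := by positivity
      simp only [Nat.choose_zero_right] at hA ⊢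
      linarith
    · obtain ⟨k, rfl⟩ : ∃ k, i = k + 1 := ⟨i - 1, by omega⟩
      have := le_tailWeight h0 h1 hγ j k (r - 1) (by push_cast at hr ⊢; omega) (by omega)
      have := mul_le_mul_of_nonneg_left this h0
      rw [Nat.choose_succ_succ]
      rw [show j + 1 - (k + 1) = j - k by omega] at hA ⊢
      push_cast
      rw [pow_succ] at hA ⊢
      linarith

/-- Blocks of `2 * m + 1` bits with exactly `m + 1` errors suffice: the binomial coefficient is at
least `4 ^ m / (2 * m)`, and this polynomial loss is beaten by the power of `4 * p * (1 - p) * γ ^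
2`. -/
theorem exists_one_le_tailWeight (h0 : 0 < p) (h1 : p < 1) (hγ : 1 ≤ γ)
    (h : 1 < 4 * p * (1 - p) * γ ^ 2) : ∃ T, 0 < T ∧ 1 ≤ tailWeight p γ T 1 := by
  have hq : 0 < 1 - p := by linarith
  have ht := tendsto_pow_const_div_const_pow_of_one_lt 1 h
  obtain ⟨m, hm, hm0⟩ := ((ht.eventually_lt_const (show (0 : ℝ) < p / 2 by positivity)).and
    (Filter.eventually_gt_atTop 0)).exists
  refine ⟨2 * m + 1, by omega, le_trans ?_ (le_tailWeight h0.le h1.le (by linarith) (2 * m + 1)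
    (m + 1) 1 (by push_cast; linarith) (by omega))⟩
  have hc : (4 : ℝ) ^ m ≤ 2 * m * (2 * m + 1).choose (m + 1) := by
    have h1 := Nat.four_pow_le_two_mul_self_mul_centralBinom m hm0
    have h2 : m.centralBinom ≤ (2 * m + 1).choose (m + 1) := by
      rw [Nat.centralBinom, Nat.choose_succ_succ]; omega
    exact_mod_cast h1.trans (Nat.mul_le_mul_left _ h2)
  rw [show 2 * m + 1 - (m + 1) = m by omega]
  rw [pow_one, div_lt_iff₀ (by positivity)] at hm
  have hm' : (0 : ℝ) < m := by exact_mod_cast hm0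
  have e : (4 * p * (1 - p) * γ ^ 2) ^ m = 4 ^ m * (p ^ m * (1 - p) ^ m * γ ^ (2 * m)) := by
    rw [pow_mul, ← mul_pow, ← mul_pow, ← mul_pow]; congr 1; ring
  rw [e] at hm
  have hX : 0 < p ^ m * (1 - p) ^ m * γ ^ (2 * m) := by positivity
  set X := p ^ m * (1 - p) ^ m * γ ^ (2 * m)
  set c : ℝ := ((2 * m + 1).choose (m + 1) : ℝ)
  have h3 := mul_le_mul_of_nonneg_right hc hX.le
  have h4 : (m : ℝ) < m * (p * (c * X)) := by nlinarith
  have h5 : 1 < p * (c * X) := by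
    by_contra! hcon
    nlinarith
  calc (1 : ℝ) ≤ 1 * (p * (c * X)) := by linarith
    _ ≤ γ * (p * (c * X)) := by gcongr
    _ = γ ^ (2 * m + 1) * (c * p ^ (m + 1) * (1 - p) ^ m) := by simp only [X]; ring

/-- Blocks of `T` bits, each with more errors than correct bits; the state records the number of
remaining bits of the block and the weight that they still have to supply. -/
noncomputable def blockPotential (h0 : 0 ≤ p) (h1 : p ≤ 1) (hγ : 1 ≤ γ) {T : ℕ} (hT : 0 < T)
    (h : 1 ≤ tailWeight p γ T 1) :
    SurvivalPotential (ℕ × ℤ) p γ (1 / T) (T + 1) (γ ^ T) where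
  -- A block that ends with the required weight is followed by a fresh one. A failed block ends in
  -- `(0, r)` with `0 < r`, where `tailWeight` is `0`, so the state is dead.
  step s a := if s.1 = 1 ∧ s.2 ≤ errorSign a then (T, 1) else (s.1 - 1, s.2 - errorSign a)
  u s := tailWeight p γ s.1 s.2
  -- The weight collected in the current block, less `1 / T` for each bit read. A successful block
  -- has collected at least `0` in this sense, so it may be reset to height `0`.
  height s := 1 - s.2 - (T - s.1) / T
  valid s := s.1 ≤ T ∧ |s.2 - 1| ≤ T - s.1 ∧ (s.1 = 0 → 0 < s.2)
  u_nonneg s := tailWeight_nonneg h0 h1 (by linarith) _ _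
  u_le s hs := (tailWeight_le h0 h1 (by linarith) _ _).trans (pow_le_pow_right₀ hγ hs.1)
  abs_height_le s hs := by
    obtain ⟨h1, h2, -⟩ := hs
    have hT' : (0 : ℝ) < T := by exact_mod_cast hT
    have h3 : (s.1 : ℝ) ≤ T := by exact_mod_cast h1
    have h4 : |(s.2 : ℝ) - 1| ≤ T - s.1 := by exact_mod_cast h2
    have h5 : 0 ≤ ((T : ℝ) - s.1) / T := div_nonneg (by linarith) hT'.le
    have h6 : ((T : ℝ) - s.1) / T ≤ 1 := by
      rw [div_le_one hT']; have : (0 : ℝ) ≤ s.1 := by positivity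
      linarith
    have h7 : (0 : ℝ) ≤ s.1 := by positivity
    rw [abs_le] at h4 ⊢
    constructor <;> linarith
  valid_step := by
    rintro ⟨j, r⟩ a ⟨h1, h2, h3⟩ hu
    simp only at h1 h2 h3 hu ⊢
    have hj : j ≠ 0 := by
      rintro rfl
      have := h3 rfl
      rw [tailWeight, if_neg (by omega)] at hu
      exact lt_irrefl _ hu
    have ha : errorSign a = 1 ∨ errorSign a = -1 := by unfold errorSign; split_ifs <;> simp
    split_ifs with hc
    · simp
    · simp only
      rw [abs_le] at h2 ⊢
      omega
  height_step := by
    rintro ⟨j, r⟩ a ⟨h1, h2, h3⟩ hu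
    simp only at h1 h2 h3 hu ⊢
    have hT' : (0 : ℝ) < T := by exact_mod_cast hT
    have hj : j ≠ 0 := by
      rintro rfl
      have := h3 rfl
      rw [tailWeight, if_neg (by omega)] at hu
      exact lt_irrefl _ hu
    split_ifs with hc
    · obtain ⟨rfl, hr⟩ := hc
      have : (r : ℝ) ≤ errorSign a := by exact_mod_cast hr
      have e : ((T : ℝ) - (1 : ℕ)) / T = 1 - 1 / T := by field_simp; simp
      simp only [e]
      simp
      linarith
    · obtain ⟨k, rfl⟩ : ∃ k, j = k + 1 := ⟨j - 1, by omega⟩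
      simp only [Nat.add_sub_cancel]
      push_cast
      apply le_of_eq
      field_simp
      ring
  u_step := by
    rintro ⟨j, r⟩ ⟨h1, h2, h3⟩ hu
    simp only at h1 h2 h3 hu ⊢
    obtain ⟨k, rfl⟩ : ∃ k, j = k + 1 := ⟨j - 1, by
      have : j ≠ 0 := by
        rintro rfl
        have := h3 rfl
        rw [tailWeight, if_neg (by omega)] at hu
        exact lt_irrefl _ hu
      omega⟩
    have key : ∀ a, tailWeight p γ k (r - errorSign a) ≤ tailWeight p γ
        (if k + 1 = 1 ∧ r ≤ errorSign a then ((T, 1) : ℕ × ℤ)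
          else (k + 1 - 1, r - errorSign a)).1
        (if k + 1 = 1 ∧ r ≤ errorSign a then ((T, 1) : ℕ × ℤ)
          else (k + 1 - 1, r - errorSign a)).2 := by
      intro a
      split_ifs with hc
      · obtain ⟨hk, hr⟩ := hc
        obtain rfl : k = 0 := by omega
        -- At the end of a successful block the value `1` is exchanged for that of a fresh block,
        -- which is no smaller.
        refine le_trans ?_ h
        unfold tailWeight
        split_ifs <;> norm_num
      · simp
    have k0 := key 0
    have k1 := key 1
    have e0 : r - errorSign 0 = r + 1 := by simp [errorSign]
    have e1 : r - errorSign 1 = r - 1 := by simp [errorSign]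
    have hq : 0 ≤ 1 - p := by linarith
    have : 0 ≤ γ := by linarith
    conv_lhs => unfold tailWeight
    rw [← e0, ← e1]
    gcongr

end

/-! ### Exploring a tree in a graph -/

section
variable {V : Type} {n : ℕ} (s t : Fin n → V)

/-- The tail of a dart: the edge `e` joins `s e` to `t e` and carries two opposite darts. -/
def dartTail (d : Fin n × Bool) : V := if d.2 then s d.1 else t d.1

/-- The head of a dart. -/
def dartHead (d : Fin n × Bool) : V := if d.2 then t d.1 else s d.1

/-- The opposite dart. -/
def dartRev (d : Fin n × Bool) : Fin n × Bool := (d.1, !d.2)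

open Classical in
/-- The darts that continue a non-backtracking walk after `d`. -/
noncomputable def nextDarts (d : Fin n × Bool) : Finset (Fin n × Bool) :=
  Finset.univ.filter fun d' => dartTail s t d' = dartHead s t d ∧ d' ≠ dartRev d

open Classical in
/-- The boundary of a set of edges modulo `2`. -/
noncomputable def boundary : (Fin n → ZMod 2) →ₗ[ZMod 2] (V → ZMod 2) where
  toFun x v := ∑ e, x e * ((if s e = v then 1 else 0) + (if t e = v then 1 else 0))
  map_add' x y := by ext v; simp [add_mul, Finset.sum_add_distrib]
  map_smul' a x := by ext v; simp [mul_assoc, Finset.mul_sum]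

open Classical in
theorem boundary_single (e : Fin n) :
    boundary s t (Pi.single e 1) = Pi.single (s e) 1 + Pi.single (t e) 1 := by
  ext v
  simp [boundary, Pi.single_apply, eq_comm]

open Classical in
theorem boundary_single_dart (d : Fin n × Bool) :
    boundary s t (Pi.single d.1 1) =
      Pi.single (dartTail s t d) 1 + Pi.single (dartHead s t d) 1 := by
  rw [boundary_single]
  unfold dartTail dartHead
  split_ifs
  · rfl
  · rw [add_comm]

/-- A tree in a graph that has been explored: its edges, its vertices, the edge sets of the paths
from the root, and the state of an automaton at every vertex. -/
structure Exploration (V σ : Type) (n : ℕ) where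
  /-- the explored edges -/
  edges : Finset (Fin n)
  /-- the received bits of the explored edges -/
  bit : Fin n → ZMod 2
  /-- the vertices of the tree -/
  verts : Finset V
  /-- the path from the root to a vertex -/
  path : V → Fin n → ZMod 2
  /-- the state at a vertex -/
  state : V → σ
  /-- the darts from live vertices to be explored -/
  pending : Finset (Fin n × Bool)

/-- The sum of `errorSign - α` over the support of `q`. -/
noncomputable def driftSum (α : ℝ) (x q : Fin n → ZMod 2) : ℝ :=
  ∑ e, if q e = 0 then 0 else (errorSign (x e) - α : ℝ)

variable {p γ α K U : ℝ} {σ : Type} (Φ : SurvivalPotential σ p γ α K U)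

open Classical in
/-- The conditions that hold throughout the exploration from the root `r`. -/
structure Exploration.Consistent (X : Exploration V σ n) (r : V) : Prop where
  edges_mem : ∀ e ∈ X.edges, s e ∈ X.verts ∧ t e ∈ X.verts
  pending_mem : ∀ d ∈ X.pending,
    dartTail s t d ∈ X.verts ∧ d.1 ∉ X.edges ∧ 0 < Φ.u (X.state (dartTail s t d))
  path_mem : ∀ y ∈ X.verts, ∀ e, X.path y e ≠ 0 → e ∈ X.edges
  path_boundary : ∀ y ∈ X.verts, boundary s t (X.path y) = Pi.single r 1 + Pi.single y 1
  valid : ∀ y ∈ X.verts, Φ.valid (X.state y)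
  -- Modulo 2, the sum of two root paths is the tree path from `y` to `z`. The loss `2 * K` pays for
  -- the height at the vertex where the root paths part.
  weight : ∀ y ∈ X.verts, ∀ z ∈ X.verts,
    Φ.height (X.state y) + Φ.height (X.state z) - 2 * K ≤
      driftSum α X.bit (X.path y + X.path z)

variable {s t} {Φ}

/-- The dart closes two root paths to a cycle. Their drift is at least `-4 * K`; giving back `α` on
each of at least `g - 1` edges leaves weight at least `1`, and the closing edge, whose bit has not
been read, costs at most `1`. -/
theorem Exploration.Consistent.undecodable_of_collision {X : Exploration V σ n} {r : V}
    (hX : X.Consistent s t Φ r) {g : ℕ} (hα : 0 ≤ α) (hK : 4 * K + 1 ≤ α * (g - 1))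
    (hg : ∀ c ∈ LinearMap.ker (boundary s t), c ≠ 0 → g ≤ hammingNorm c)
    {d : Fin n × Bool} (hd : d ∈ X.pending) (hcol : dartHead s t d ∈ X.verts)
    (x : Fin n → ZMod 2) (hx : ∀ e ∈ X.edges, x e = X.bit e) :
    Undecodable (LinearMap.ker (boundary s t)) x := by
  classical
  obtain ⟨h1, h2, -⟩ := hX.pending_mem d hd
  set q := X.path (dartTail s t d) + X.path (dartHead s t d) with hq
  have hqmem : ∀ e, q e ≠ 0 → e ∈ X.edges := by
    intro e he
    by_contra hcon
    have a1 := not_imp_comm.1 (hX.path_mem _ h1 e) hcon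
    have a2 := not_imp_comm.1 (hX.path_mem _ hcol e) hcon
    exact he (by simp [hq, a1, a2])
  have hqd : q d.1 = 0 := not_imp_comm.1 (hqmem d.1) h2
  set c : Fin n → ZMod 2 := q + Pi.single d.1 1 with hc
  have hcd : c d.1 = 1 := by simp [hc, hqd]
  have hce : ∀ e, e ≠ d.1 → c e = q e := fun e he => by simp [hc, he]
  have hc0 : c ≠ 0 := fun h => by rw [h] at hcd; simp at hcd
  have hcm : c ∈ LinearMap.ker (boundary s t) := by
    rw [LinearMap.mem_ker, hc, map_add, hq, map_add, boundary_single_dart,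
      hX.path_boundary _ h1, hX.path_boundary _ hcol]
    have h2 : ∀ a b c : ZMod 2, a + b + (a + c) + (b + c) = 0 := by decide
    ext v
    simp only [Pi.add_apply, Pi.zero_apply]
    exact h2 _ _ _
  have hsum : ∀ f : Fin n → ℝ, (∑ e, if c e = 0 then 0 else f e) =
      (∑ e, if q e = 0 then 0 else f e) + f d.1 := by
    intro f
    rw [← Finset.add_sum_erase _ _ (Finset.mem_univ d.1),
      ← Finset.add_sum_erase (s := Finset.univ) (f := fun e => if q e = 0 then 0 else f e)
        (Finset.mem_univ d.1), hqd, hcd]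
    simp only [one_ne_zero, if_false, if_true, zero_add]
    rw [add_comm]
    congr 1
    exact Finset.sum_congr rfl fun e he => by rw [hce e (Finset.ne_of_mem_erase he)]
  have hnorm : (hammingNorm c : ℝ) = (∑ e, if q e = 0 then 0 else (1 : ℝ)) + 1 := by
    rw [← hsum]
    simp [hammingNorm, Finset.card_filter, ite_not]
  have hg' : (g : ℝ) ≤ hammingNorm c := by exact_mod_cast hg c hcm hc0
  refine undecodable_of_sum_errorSign hcm hc0 ?_
  have hw := hX.weight _ h1 _ hcol
  have e1 : driftSum α X.bit q =
      (∑ e, if q e = 0 then 0 else (errorSign (x e) : ℝ)) -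
        α * ∑ e, if q e = 0 then 0 else (1 : ℝ) := by
    rw [driftSum, Finset.mul_sum, ← Finset.sum_sub_distrib]
    refine Finset.sum_congr rfl fun e _ => ?_
    split_ifs with h
    · simp
    · rw [hx e (hqmem e h)]; simp
  rw [← hq, e1] at hw
  have b1 := (abs_le.1 (Φ.abs_height_le _ (hX.valid _ h1))).1
  have b2 := (abs_le.1 (Φ.abs_height_le _ (hX.valid _ hcol))).1
  have b3 : (-1 : ℝ) ≤ errorSign (x d.1) := by
    unfold errorSign; split_ifs <;> norm_num
  have b4 : α * ((g : ℝ) - 1) ≤ α * ∑ e, if q e = 0 then 0 else (1 : ℝ) :=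
    mul_le_mul_of_nonneg_left (by linarith) hα
  have hfin : (0 : ℝ) ≤ ∑ e, if c e = 0 then 0 else (errorSign (x e) : ℝ) := by
    rw [hsum]; linarith
  have : ((∑ e, if c e = 0 then 0 else errorSign (x e) : ℤ) : ℝ) =
      ∑ e, if c e = 0 then 0 else (errorSign (x e) : ℝ) := by
    push_cast [apply_ite]; simp
  exact_mod_cast this ▸ hfin

open Classical in
/-- The exploration after the dart `d` with the received bit `a`. -/
noncomputable def Exploration.extend (X : Exploration V σ n) (s t : Fin n → V)
    (Φ : SurvivalPotential σ p γ α K U) (d : Fin n × Bool) (a : ZMod 2) : Exploration V σ n where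
  edges := insert d.1 X.edges
  bit := Function.update X.bit d.1 a
  verts := insert (dartHead s t d) X.verts
  path := Function.update X.path (dartHead s t d)
    (X.path (dartTail s t d) + Pi.single d.1 1)
  state := Function.update X.state (dartHead s t d) (Φ.step (X.state (dartTail s t d)) a)
  pending := X.pending.erase d ∪
    if 0 < Φ.u (Φ.step (X.state (dartTail s t d)) a) then nextDarts s t d else ∅

/-- The head of `d` becomes a leaf. Its paths to the old vertices gain one fresh edge, whose drift
is exactly the amount that `height_step` allows. -/
theorem Exploration.Consistent.extend {X : Exploration V σ n} {r : V}
    (hX : X.Consistent s t Φ r)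
    {d : Fin n × Bool} (hd : d ∈ X.pending) (hcol : dartHead s t d ∉ X.verts) (a : ZMod 2) :
    (X.extend s t Φ d a).Consistent s t Φ r := by
  classical
  obtain ⟨h1, h2, h3⟩ := hX.pending_mem d hd
  set z := dartHead s t d with hz
  set y₀ := dartTail s t d with hy₀
  have hne : ∀ y ∈ X.verts, y ≠ z := fun y hy h => hcol (h ▸ hy)
  have hends : s d.1 ∈ insert z X.verts ∧ t d.1 ∈ insert z X.verts := by
    rw [hz]; rw [hy₀] at h1
    unfold dartHead dartTail at *
    split_ifs at * <;> simp [h1]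
  have hzmem : ∀ d' : Fin n × Bool, dartTail s t d' = z → d'.1 ∉ X.edges := by
    intro d' hd' he
    have := hX.edges_mem _ he
    unfold dartTail at hd'
    split_ifs at hd'
    · exact hcol (hd' ▸ this.1)
    · exact hcol (hd' ▸ this.2)
  have hedge : ∀ d' : Fin n × Bool, d'.1 = d.1 → d' = d ∨ d' = dartRev d := by
    rintro ⟨e, b⟩ h
    obtain ⟨e', b'⟩ := d
    simp only at h
    subst h
    cases b <;> cases b' <;> simp [dartRev]
  have hrev : dartTail s t (dartRev d) = z := by
    rw [hz]; unfold dartRev dartTail dartHead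
    cases d.2 <;> simp
  have hpathd : ∀ y ∈ X.verts, X.path y d.1 = 0 := fun y hy =>
    not_imp_comm.1 (hX.path_mem y hy d.1) h2
  constructor
  · intro e he
    simp only [Exploration.extend, Finset.mem_insert] at he ⊢
    rcases he with rfl | he
    · simpa using hends
    · exact ⟨Or.inr (hX.edges_mem e he).1, Or.inr (hX.edges_mem e he).2⟩
  · intro d' hd'
    simp only [Exploration.extend, Finset.mem_union, Finset.mem_erase] at hd' ⊢
    rcases hd' with ⟨hdne, hd'⟩ | hd'
    · obtain ⟨k1, k2, k3⟩ := hX.pending_mem d' hd'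
      refine ⟨Finset.mem_insert_of_mem k1, ?_, ?_⟩
      -- Another pending dart on the same edge would be the reverse of `d`, whose tail is the vertex
      -- just discovered.
      · rw [Finset.mem_insert, not_or]
        refine ⟨fun h => ?_, k2⟩
        rcases hedge d' h with h | h
        · exact hdne h
        · exact hne _ k1 (h ▸ hrev)
      · rwa [Function.update_of_ne (hne _ k1)]
    · split_ifs at hd' with hu
      · simp only [nextDarts, Finset.mem_filter, Finset.mem_univ, true_and] at hd'
        obtain ⟨k1, k2⟩ := hd'
        rw [k1]
        refine ⟨Finset.mem_insert_self _ _, ?_, ?_⟩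
        · rw [Finset.mem_insert, not_or]
          refine ⟨fun h => ?_, hzmem d' k1⟩
          rcases hedge d' h with h | h
          · exact hne _ h1 (by rw [hy₀, ← h, k1])
          · exact k2 h
        · rwa [← hz, Function.update_self]
      · simp at hd'
  · intro y hy e he
    simp only [Exploration.extend, Finset.mem_insert] at hy he ⊢
    rcases hy with rfl | hy
    · rw [← hz, Function.update_self] at he
      by_cases h : e = d.1
      · exact Or.inl h
      · right
        refine hX.path_mem _ h1 e ?_
        simpa [h] using he
    · rw [Function.update_of_ne (hne y hy)] at he
      exact Or.inr (hX.path_mem y hy e he)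
  · intro y hy
    simp only [Exploration.extend, Finset.mem_insert] at hy ⊢
    rcases hy with rfl | hy
    · rw [← hz, Function.update_self, map_add, hX.path_boundary _ h1, boundary_single_dart]
      have h2 : ∀ a b c : ZMod 2, a + b + (b + c) = a + c := by decide
      ext v
      simp only [Pi.add_apply]
      exact h2 _ _ _
    · rw [← hz, Function.update_of_ne (hne y hy)]
      exact hX.path_boundary y hy
  · intro y hy
    simp only [Exploration.extend, Finset.mem_insert] at hy ⊢
    rcases hy with rfl | hy
    · rw [← hz, Function.update_self]
      exact Φ.valid_step _ _ (hX.valid _ h1) h3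
    · rw [← hz, Function.update_of_ne (hne y hy)]
      exact hX.valid y hy
  · have hbit : ∀ q : Fin n → ZMod 2, q d.1 = 0 →
        driftSum α (Function.update X.bit d.1 a) q = driftSum α X.bit q := by
      intro q hq
      refine Finset.sum_congr rfl fun e _ => ?_
      by_cases h : e = d.1
      · rw [h, hq]; simp
      · rw [Function.update_of_ne h]
    have hadd : ∀ q : Fin n → ZMod 2, q d.1 = 0 →
        driftSum α (Function.update X.bit d.1 a) (q + Pi.single d.1 1) =
          driftSum α X.bit q + (errorSign a - α) := by
      intro q hq
      rw [← hbit q hq, driftSum, driftSum, ← Finset.add_sum_erase _ _ (Finset.mem_univ d.1),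
        ← Finset.add_sum_erase (s := Finset.univ) (f := fun e => if q e = 0 then 0 else
          (errorSign (Function.update X.bit d.1 a e) - α : ℝ)) (Finset.mem_univ d.1)]
      simp only [Pi.add_apply, hq, Pi.single_eq_same, zero_add, one_ne_zero, if_false, if_true,
        Function.update_self]
      rw [add_comm]
      congr 1
      exact Finset.sum_congr rfl fun e he => by
        simp [Finset.ne_of_mem_erase he]
    have hstep := Φ.height_step _ a (hX.valid _ h1) h3
    have hself : ∀ q : Fin n → ZMod 2, q + q = 0 := fun q => by
      ext e; exact CharTwo.add_self_eq_zero _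
    have hnew : ∀ y ∈ X.verts, Φ.height (X.state y) +
        Φ.height (Φ.step (X.state y₀) a) - 2 * K ≤
        driftSum α (Function.update X.bit d.1 a) (X.path y + (X.path y₀ + Pi.single d.1 1)) := by
      intro y hy
      rw [← add_assoc, hadd _ (by simp [hpathd y hy, hpathd y₀ h1])]
      have := hX.weight y hy y₀ h1
      linarith
    intro y hy y' hy'
    simp only [Exploration.extend, Finset.mem_insert] at hy hy' ⊢
    rw [← hz, ← hy₀]
    rcases hy with rfl | hy <;> rcases hy' with rfl | hy'
    -- For the new vertex paired with itself the path is empty, and the claim is that its height is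
    -- at most `K`.
    · rw [← hz]
      simp only [Function.update_self, hself, driftSum, Pi.zero_apply, if_true, Finset.sum_const_zero]
      have := (abs_le.1 (Φ.abs_height_le _ (Φ.valid_step _ a (hX.valid _ h1) h3))).2
      linarith
    · rw [← hz, Function.update_self, Function.update_self, Function.update_of_ne (hne y' hy'),
        Function.update_of_ne (hne y' hy'), add_comm (Φ.height _), add_comm (_ + _) (X.path y')]
      exact hnew y' hy'
    · rw [← hz, Function.update_self, Function.update_self, Function.update_of_ne (hne y hy),
        Function.update_of_ne (hne y hy)]
      exact hnew y hy
    · rw [Function.update_of_ne (hne y hy), Function.update_of_ne (hne y hy),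
        Function.update_of_ne (hne y' hy'), Function.update_of_ne (hne y' hy'),
        hbit _ (by simp [hpathd y hy, hpathd y' hy'])]
      exact hX.weight y hy y' hy'

end

/-! ### The branching process bounds the error probability -/

section
variable {V : Type} {n : ℕ} {s t : Fin n → V}
variable {p γ α K U : ℝ} {σ : Type} {Φ : SurvivalPotential σ p γ α K U}

/-- Children of total mass at least `l * y` survive at least as well as one particle of mass `γ *
y`: for small masses the gap `l - γ` absorbs the second-order loss. -/
theorem prod_one_sub_le {ι : Type*} (A : Finset ι) (x : ι → ℝ) {l γ τ y : ℝ}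
    (hl : 0 < l) (hτ : 0 ≤ τ) (hx : ∀ i ∈ A, τ * x i ≤ 1)
    (hy : 0 ≤ y) (hsum : l * y ≤ ∑ i ∈ A, x i) (hsmall : l * γ * (τ * y) ≤ l - γ) :
    ∏ i ∈ A, (1 - τ * x i) ≤ 1 - γ * (τ * y) := by
  have hty : 0 ≤ τ * y := by positivity
  have hlt : 0 ≤ l * (τ * y) := by positivity
  calc ∏ i ∈ A, (1 - τ * x i) ≤ ∏ i ∈ A, Real.exp (-(τ * x i)) := by
        refine Finset.prod_le_prod (fun i hi => by linarith [hx i hi]) fun i _ => ?_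
        linarith [Real.add_one_le_exp (-(τ * x i))]
    _ = Real.exp (-(τ * ∑ i ∈ A, x i)) := by
        rw [← Real.exp_sum, Finset.sum_neg_distrib, Finset.mul_sum]
    _ ≤ Real.exp (-(l * (τ * y))) := by
        refine Real.exp_le_exp.2 ?_
        nlinarith [mul_le_mul_of_nonneg_left hsum hτ]
    _ ≤ (1 + l * (τ * y))⁻¹ := by
        rw [Real.exp_neg]
        refine inv_anti₀ (by linarith) ?_
        linarith [Real.add_one_le_exp (l * (τ * y))]
    _ ≤ 1 - γ * (τ * y) := by
        rw [inv_le_iff_one_le_mul₀ (by linarith)]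
        -- With `z = τ * y` this is `1 ≤ (1 - γ * z) * (1 + l * z)`.
        nlinarith [mul_le_mul_of_nonneg_right hsmall hty]

open Classical in
/-- The probability that the received word is undecodable, given the explored bits. -/
noncomputable def Exploration.errorProb (X : Exploration V σ n) (p : ℝ)
    (C : Submodule (ZMod 2) (Fin n → ZMod 2)) : ℝ :=
  ∑ x, (if Undecodable C fun e => if e ∈ X.edges then X.bit e else x e then (1 : ℝ) else 0) *
    bscProb p 0 x

theorem Exploration.errorProb_extend (X : Exploration V σ n)
    (C : Submodule (ZMod 2) (Fin n → ZMod 2)) {d : Fin n × Bool} (hd : d.1 ∉ X.edges) :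
    X.errorProb p C = (1 - p) * (X.extend s t Φ d 0).errorProb p C +
      p * (X.extend s t Φ d 1).errorProb p C := by
  classical
  unfold Exploration.errorProb
  rw [sum_bscProb_update p _ d.1]
  have key : ∀ (a : ZMod 2) (x : Fin n → ZMod 2),
      (fun e => if e ∈ X.edges then X.bit e else Function.update x d.1 a e) =
      fun e => if e ∈ (X.extend s t Φ d a).edges then (X.extend s t Φ d a).bit e else x e := by
    intro a x
    ext e
    by_cases h : e = d.1
    · subst h; simp [Exploration.extend, hd]
    · simp [Exploration.extend, h]
  simp only [key]

/-- Pending darts are treated as independent particles. Reading a bit may shrink the mean potential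
by a factor `γ`, which the continuations win back by `prod_one_sub_le`. The induction is on the
number of unexplored edges: a collision makes the error certain, and with nothing pending the bound
is `0`, so no estimate of the survival time is needed. -/
theorem Exploration.Consistent.le_errorProb (hp0 : 0 ≤ p) (hp1 : p ≤ 1) (hγ : 1 ≤ γ)
    {g : ℕ} (hα : 0 ≤ α) (hK : 4 * K + 1 ≤ α * (g - 1))
    (hg : ∀ c ∈ LinearMap.ker (boundary s t), c ≠ 0 → g ≤ hammingNorm c)
    {x : Fin n × Bool → ℝ} (hx0 : ∀ d, 0 ≤ x d) (hx1 : ∀ d, x d ≤ 1) {l κ : ℝ} (hl : γ < l)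
    (hx : ∀ d, l * x d ≤ ∑ d' ∈ nextDarts s t d, x d') (hκ0 : 0 ≤ κ)
    (hκ : l * γ * (κ * U) ≤ l - γ) {r : V} (k : ℕ) :
    ∀ X : Exploration V σ n, X.Consistent s t Φ r → n - X.edges.card = k →
      1 - ∏ d ∈ X.pending, (1 - κ * Φ.u (X.state (dartTail s t d)) * x d) ≤
        X.errorProb p (LinearMap.ker (boundary s t)) := by
  classical
  induction k using Nat.strong_induction_on with
  | _ k ih =>
  intro X hX hcard
  have hsmall : ∀ s d, Φ.valid s → κ * Φ.u s * x d ≤ κ * U := fun s d hs => by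
    have h1 := Φ.u_le s hs
    have h2 := Φ.u_nonneg s
    calc κ * Φ.u s * x d ≤ κ * U * 1 :=
          mul_le_mul (mul_le_mul_of_nonneg_left h1 hκ0) (hx1 d) (hx0 d)
            (mul_nonneg hκ0 (h2.trans h1))
      _ = κ * U := mul_one _
  have hκU : κ * U ≤ 1 := by
    by_contra! hcon
    have : l * 1 < l * (γ * (κ * U)) := mul_lt_mul_of_pos_left (by nlinarith) (by linarith)
    linarith
  have hfac : ∀ s d, Φ.valid s → 0 ≤ 1 - κ * Φ.u s * x d := fun s d hs => by
    linarith [hsmall s d hs]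
  have hpend : ∀ d ∈ X.pending, 0 ≤ 1 - κ * Φ.u (X.state (dartTail s t d)) * x d :=
    fun d hd => hfac _ _ (hX.valid _ (hX.pending_mem d hd).1)
  rcases X.pending.eq_empty_or_nonempty with hemp | ⟨d, hd⟩
  · rw [hemp, Finset.prod_empty, sub_self]
    refine Finset.sum_nonneg fun x _ => mul_nonneg ?_ (bscProb_nonneg hp0 hp1 _ _)
    split_ifs <;> norm_num
  obtain ⟨h1, h2, h3⟩ := hX.pending_mem d hd
  by_cases hcol : dartHead s t d ∈ X.verts
  · have : X.errorProb p (LinearMap.ker (boundary s t)) = 1 := by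
      rw [← sum_bscProb p n]
      refine Finset.sum_congr rfl fun x _ => ?_
      rw [if_pos, one_mul]
      exact hX.undecodable_of_collision hα hK hg hd hcol _ fun e he => by simp [he]
    rw [this]
    linarith [Finset.prod_nonneg hpend]
  rw [X.errorProb_extend (s := s) (t := t) (Φ := Φ) _ h2]
  have hlt : n - (insert d.1 X.edges).card < k := by
    have hle : (insert d.1 X.edges).card ≤ n := by
      simpa using Finset.card_le_univ (insert d.1 X.edges)
    rw [Finset.card_insert_of_notMem h2] at hle ⊢
    omega
  set y₀ := dartTail s t d with hy₀
  set R := ∏ d' ∈ X.pending.erase d, (1 - κ * Φ.u (X.state (dartTail s t d')) * x d') with hR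
  have hR0 : 0 ≤ R := Finset.prod_nonneg fun d' hd' => hpend d' (Finset.mem_of_mem_erase hd')
  have hext : ∀ a, 1 - R * (1 - γ * (κ * Φ.u (Φ.step (X.state y₀) a) * x d)) ≤
      (X.extend s t Φ d a).errorProb p (LinearMap.ker (boundary s t)) := by
    intro a
    refine le_trans ?_ (ih _ hlt _ (hX.extend hd hcol a) rfl)
    have hv := Φ.valid_step _ a (hX.valid _ h1) h3
    have hsplit : ∏ d' ∈ (X.extend s t Φ d a).pending,
        (1 - κ * Φ.u ((X.extend s t Φ d a).state (dartTail s t d')) * x d') =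
        R * ∏ d' ∈ (if 0 < Φ.u (Φ.step (X.state y₀) a) then nextDarts s t d else ∅),
          (1 - κ * Φ.u (Φ.step (X.state y₀) a) * x d') := by
      have htail : ∀ d' ∈ (if 0 < Φ.u (Φ.step (X.state y₀) a) then nextDarts s t d else ∅),
          dartTail s t d' = dartHead s t d := by
        intro d' hd'
        split_ifs at hd'
        · exact (Finset.mem_filter.1 hd').2.1
        · simp at hd'
      have htail' : ∀ d' ∈ X.pending.erase d, dartTail s t d' ≠ dartHead s t d :=
        fun d' hd' h => hcol (h ▸ (hX.pending_mem d' (Finset.mem_of_mem_erase hd')).1)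
      simp only [Exploration.extend]
      rw [Finset.prod_union (Finset.disjoint_left.2 fun d' h1 h2 => htail' d' h1 (htail d' h2))]
      congr 1
      · refine Finset.prod_congr rfl fun d' hd' => ?_
        rw [Function.update_of_ne (htail' d' hd')]
      · refine Finset.prod_congr rfl fun d' hd' => ?_
        rw [htail d' hd', Function.update_self]
    rw [hsplit]
    refine sub_le_sub_left (mul_le_mul_of_nonneg_left ?_ hR0) 1
    have hu0 := Φ.u_nonneg (Φ.step (X.state y₀) a)
    split_ifs with hu
    · rw [show γ * (κ * Φ.u (Φ.step (X.state y₀) a) * x d) =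
        γ * ((κ * Φ.u (Φ.step (X.state y₀) a)) * x d) by ring]
      refine prod_one_sub_le (l := l) _ x (by linarith) (by positivity)
        (fun d' _ => by linarith [hsmall _ d' hv]) (hx0 d) (hx d) ?_
      refine le_trans ?_ hκ
      exact mul_le_mul_of_nonneg_left (hsmall _ d hv) (by nlinarith)
    · rw [le_antisymm (not_lt.1 hu) hu0]
      simp
  have hstep := Φ.u_step _ (hX.valid _ h1) h3
  have e0 := mul_le_mul_of_nonneg_left (hext 0) (by linarith : 0 ≤ 1 - p)
  have e1 := mul_le_mul_of_nonneg_left (hext 1) hp0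
  have e2 : 0 ≤ R * (κ * x d) := mul_nonneg hR0 (mul_nonneg hκ0 (hx0 d))
  have e3 := mul_le_mul_of_nonneg_left hstep e2
  rw [← Finset.mul_prod_erase _ _ hd, ← hR, ← hy₀]
  nlinarith

open Classical in
/-- A graph without short cycles whose non-backtracking walks grow at a rate `l > γ` has
undecodable words with probability bounded away from zero. -/
theorem le_errorProb_of_growth (Φ : SurvivalPotential σ p γ α K U)
    (hp0 : 0 ≤ p) (hp1 : p ≤ 1) (hγ : 1 ≤ γ)
    {g : ℕ} (hα : 0 ≤ α) (hK : 4 * K + 1 ≤ α * (g - 1))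
    (hg : ∀ c ∈ LinearMap.ker (boundary s t), c ≠ 0 → g ≤ hammingNorm c)
    {x : Fin n × Bool → ℝ} (hx0 : ∀ d, 0 ≤ x d) (hx1 : ∀ d, x d ≤ 1) {l κ : ℝ} (hl : γ < l)
    (hx : ∀ d, l * x d ≤ ∑ d' ∈ nextDarts s t d, x d') (hκ0 : 0 ≤ κ)
    (hκ : l * γ * (κ * U) ≤ l - γ) {d₀ : Fin n × Bool} (hd₀ : x d₀ = 1)
    {s₀ : σ} (hs₀ : Φ.valid s₀) (hu₀ : 1 ≤ Φ.u s₀) :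
    κ ≤ ∑ x, (if Undecodable (LinearMap.ker (boundary s t)) x then (1 : ℝ) else 0) *
      bscProb p 0 x := by
  -- With `d₀` alone pending and `x d₀ = 1`, the bound is `κ * Φ.u s₀`.
  let X : Exploration V σ n :=
    { edges := ∅, bit := 0, verts := {dartTail s t d₀}, path := 0, state := fun _ => s₀,
      pending := {d₀} }
  have hX : X.Consistent s t Φ (dartTail s t d₀) := by
    constructor
    · simp [X]
    · simp only [X, Finset.mem_singleton]
      rintro d rfl
      exact ⟨rfl, by simp, by linarith⟩
    · simp [X]
    · simp only [X, Finset.mem_singleton]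
      rintro y rfl
      ext v
      simp [CharTwo.add_self_eq_zero]
    · exact fun _ _ => hs₀
    · intro y _ z _
      have := (abs_le.1 (Φ.abs_height_le _ hs₀)).2
      simp only [X, driftSum, Pi.zero_apply, Pi.add_apply, add_zero, if_true, Finset.sum_const_zero]
      linarith
  have := Exploration.Consistent.le_errorProb hp0 hp1 hγ hα hK hg hx0 hx1 hl hx hκ0 hκ _ X hX rfl
  simp only [X, Finset.prod_singleton, hd₀, Exploration.errorProb, Finset.notMem_empty,
    if_false] at this
  refine le_trans ?_ this
  nlinarith

end

/-! ### Growth rates from Jensen's inequality -/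

section
variable {ι : Type*}

theorem log_card_add_le_log_sum {A : Finset ι} (hA : A.Nonempty) {f : ι → ℝ}
    (hf : ∀ i ∈ A, 0 < f i) :
    Real.log A.card + ∑ i ∈ A, 1 / (A.card : ℝ) * Real.log (f i) ≤ Real.log (∑ i ∈ A, f i) := by
  have hc : (0 : ℝ) < A.card := by exact_mod_cast hA.card_pos
  have h := strictConcaveOn_log_Ioi.concaveOn.le_map_sum (t := A) (w := fun _ => 1 / (A.card : ℝ))
    (p := f) (fun i _ => by positivity) (by simp [hc.ne']) (fun i hi => hf i hi)
  simp only [smul_eq_mul] at h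
  rw [← Finset.mul_sum (f := f), Real.log_mul (by positivity) (Finset.sum_pos hf hA).ne', one_div,
    Real.log_inv] at h
  simp only [one_div]
  linarith

variable [Fintype ι] [DecidableEq ι]

/-- Let `A` sum a function over successors. By `hbal` the uniform step to a successor is doubly
stochastic, so by Jensen `A` raises the sum of logarithms by at least `N * log l`, and `A ^ k 1` has
an entry at least `l ^ k`. Normalized partial sums of `l ^ (-k) * A ^ k 1` satisfy the inequality up
to a vanishing error; compactness gives an exact solution. -/
theorem exists_superharmonic_of_sum_log_le [Nonempty ι] (next : ι → Finset ι)
    (hne : ∀ i, (next i).Nonempty)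
    (hbal : ∀ j, ∑ i with j ∈ next i, 1 / ((next i).card : ℝ) = 1) {l : ℝ} (hl : 0 < l)
    (h : Fintype.card ι * Real.log l ≤ ∑ i, Real.log (next i).card) :
    ∃ x : ι → ℝ, (∀ i, 0 ≤ x i) ∧ (∀ i, x i ≤ 1) ∧ (∃ i, x i = 1) ∧
      ∀ i, l * x i ≤ ∑ j ∈ next i, x j := by
  set N : ℝ := (Fintype.card ι : ℝ) with hN
  have hNpos : 0 < N := by rw [hN]; exact_mod_cast Fintype.card_pos
  have hstep : ∀ f : ι → ℝ, (∀ i, 0 < f i) →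
      N * Real.log l + ∑ i, Real.log (f i) ≤ ∑ i, Real.log (∑ j ∈ next i, f j) := by
    intro f hf
    have e : ∑ i, ∑ j ∈ next i, 1 / ((next i).card : ℝ) * Real.log (f j) =
        ∑ j, Real.log (f j) := by
      rw [Finset.sum_comm' (t' := Finset.univ)
        (s' := fun j => Finset.univ.filter fun i => j ∈ next i) (by simp)]
      refine Finset.sum_congr rfl fun j _ => ?_
      rw [← Finset.sum_mul, hbal, one_mul]
    rw [← e]
    refine (add_le_add_left h _).trans ?_
    rw [← Finset.sum_add_distrib]
    exact Finset.sum_le_sum fun i _ => log_card_add_le_log_sum (hne i) fun j _ => hf j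
  let b : ℕ → ι → ℝ := fun k => Nat.rec (fun _ => 1) (fun _ f i => ∑ j ∈ next i, f j) k
  have hb : ∀ k i, b (k + 1) i = ∑ j ∈ next i, b k j := fun k i => rfl
  have hbpos : ∀ k i, 0 < b k i := by
    intro k
    induction k with
    | zero => intro i; exact one_pos
    | succ k ih => intro i; rw [hb]; exact Finset.sum_pos (fun j _ => ih j) (hne i)
  have hblog : ∀ k : ℕ, k * (N * Real.log l) ≤ ∑ i, Real.log (b k i) := by
    intro k
    induction k with
    | zero => simp [b]
    | succ k ih =>
      have := hstep (b k) (hbpos k)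
      simp only [← hb] at this
      push_cast
      linarith
  have hbsum : ∀ k, 1 ≤ ∑ i, b k i / l ^ k := by
    intro k
    obtain ⟨i, -, hi⟩ : ∃ i ∈ (Finset.univ : Finset ι), k * Real.log l ≤ Real.log (b k i) := by
      refine Finset.exists_le_of_sum_le Finset.univ_nonempty ?_
      rw [Finset.sum_const, Finset.card_univ, nsmul_eq_mul]
      linarith [hblog k]
    rw [← Real.log_pow, Real.log_le_log_iff (by positivity) (hbpos k i)] at hi
    refine le_trans ?_ (Finset.single_le_sum (f := fun i => b k i / l ^ k)
      (fun i _ => (div_pos (hbpos k i) (by positivity)).le) (Finset.mem_univ i))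
    rwa [le_div_iff₀ (by positivity), one_mul]
  let X : ℕ → ι → ℝ := fun K i => ∑ k ∈ Finset.range K, b k i / l ^ k
  have hX0 : ∀ K i, 0 ≤ X K i := fun K i =>
    Finset.sum_nonneg fun k _ => (div_pos (hbpos k i) (by positivity)).le
  -- Summing over successors shifts the series by one term; only the term `k = 0`, which is `1`, is
  -- lost.
  have hXstep : ∀ K i, l * X K i - l ≤ ∑ j ∈ next i, X K j := by
    intro K i
    have e : ∑ j ∈ next i, X K j = l * ∑ k ∈ Finset.range K, b (k + 1) i / l ^ (k + 1) := by
      simp only [X]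
      rw [Finset.sum_comm, Finset.mul_sum]
      refine Finset.sum_congr rfl fun k _ => ?_
      rw [← Finset.sum_div, ← hb]
      field_simp
      ring
    have e2 : X K i ≤ ∑ k ∈ Finset.range (K + 1), b k i / l ^ k := by
      rw [Finset.sum_range_succ]
      have := (div_pos (hbpos K i) (pow_pos hl K)).le
      simp only [X]
      linarith
    rw [Finset.sum_range_succ'] at e2
    have e3 : b 0 i / l ^ 0 = 1 := by simp [b]
    rw [e]
    nlinarith [mul_le_mul_of_nonneg_left e2 hl.le]
  -- Approximate solutions; the entry equal to `1` keeps the limit away from zero.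
  let Z : ℕ → Set (ι → ℝ) := fun K => Set.Icc 0 1 ∩ ((⋃ i, {x | x i = 1}) ∩
    ⋂ i, {x | l * x i - l * N / (K + 1) ≤ ∑ j ∈ next i, x j})
  have hZclosed : ∀ K, IsClosed (Z K) := fun K =>
    isClosed_Icc.inter ((isClosed_iUnion_of_finite fun i =>
      isClosed_eq (continuous_apply i) continuous_const).inter
      (isClosed_iInter fun i => isClosed_le (by fun_prop) (by fun_prop)))
  have hZne : ∀ K, (Z K).Nonempty := by
    intro K
    obtain ⟨i₀, -, hi₀⟩ := Finset.exists_max_image Finset.univ (X (K + 1)) Finset.univ_nonempty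
    have hM : (K + 1 : ℝ) ≤ N * X (K + 1) i₀ := by
      calc (K + 1 : ℝ) = ∑ k ∈ Finset.range (K + 1), (1 : ℝ) := by simp
        _ ≤ ∑ k ∈ Finset.range (K + 1), ∑ i, b k i / l ^ k :=
          Finset.sum_le_sum fun k _ => hbsum k
        _ = ∑ i, X (K + 1) i := Finset.sum_comm
        _ ≤ ∑ i : ι, X (K + 1) i₀ := Finset.sum_le_sum fun i hi => hi₀ i hi
        _ = N * X (K + 1) i₀ := by simp [hN]
    have hK : (0 : ℝ) < K + 1 := by positivity
    have hMpos : 0 < X (K + 1) i₀ := by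
      by_contra! hcon
      nlinarith
    refine ⟨fun i => X (K + 1) i / X (K + 1) i₀, ⟨fun i => div_nonneg (hX0 _ i) hMpos.le,
      fun i => (div_le_one hMpos).2 (hi₀ i (Finset.mem_univ i))⟩,
      Set.mem_iUnion.2 ⟨i₀, div_self hMpos.ne'⟩, Set.mem_iInter.2 fun i => ?_⟩
    show l * (X (K + 1) i / X (K + 1) i₀) - l * N / (K + 1) ≤
      ∑ j ∈ next i, X (K + 1) j / X (K + 1) i₀
    rw [← Finset.sum_div]
    have h1 := div_le_div_of_nonneg_right (hXstep (K + 1) i) hMpos.le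
    have h2 : l / X (K + 1) i₀ ≤ l * N / (K + 1) := by
      rw [div_le_div_iff₀ hMpos hK, mul_assoc]
      exact mul_le_mul_of_nonneg_left hM hl.le
    rw [sub_div, mul_div_assoc] at h1
    linarith
  have hZanti : ∀ K, Z (K + 1) ⊆ Z K := by
    rintro K x ⟨h1, h2, h3⟩
    refine ⟨h1, h2, Set.mem_iInter.2 fun i => ?_⟩
    have h4 : l * x i - l * N / ((K + 1 : ℕ) + 1) ≤ ∑ j ∈ next i, x j := Set.mem_iInter.1 h3 i
    refine le_trans ?_ h4
    refine sub_le_sub_left (div_le_div_of_nonneg_left (by positivity) (by positivity) ?_) _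
    push_cast
    linarith
  obtain ⟨x, hx⟩ := IsCompact.nonempty_iInter_of_sequence_nonempty_isCompact_isClosed Z hZanti
    hZne (isCompact_Icc.of_isClosed_subset (hZclosed 0) Set.inter_subset_left) hZclosed
  rw [Set.mem_iInter] at hx
  obtain ⟨i₀, hi₀⟩ := Set.mem_iUnion.1 (hx 0).2.1
  refine ⟨x, fun i => (hx 0).1.1 i, fun i => (hx 0).1.2 i, ⟨i₀, hi₀⟩, fun i => ?_⟩
  refine ge_of_tendsto' (x := Filter.atTop)
    (f := fun K : ℕ => (∑ j ∈ next i, x j) + l * N / ((K : ℝ) + 1)) ?_ fun K => ?_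
  · have := tendsto_const_div_atTop_nhds_zero_nat (l * N)
    have := ((Filter.tendsto_add_atTop_iff_nat 1).2 this).const_add (∑ j ∈ next i, x j)
    simpa using this
  · have : l * x i - l * N / (K + 1) ≤ ∑ j ∈ next i, x j := Set.mem_iInter.1 (hx K).2.2 i
    linarith

end

/-! ### Edge sets that are minimal for their rate -/

section
variable {V : Type} {n : ℕ} (s t : Fin n → V)

open Classical in
theorem boundary_apply (x : Fin n → ZMod 2) (v : V) :
    boundary s t x v = ∑ d : Fin n × Bool with dartTail s t d = v, x d.1 := by
  change ∑ e, x e * ((if s e = v then 1 else 0) + (if t e = v then 1 else 0)) = _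
  rw [Finset.sum_filter, Fintype.sum_prod_type]
  refine Finset.sum_congr rfl fun e _ => ?_
  simp [dartTail, mul_add]

/-- The even edge sets of a graph that are contained in `S`. -/
noncomputable def cyclesIn (S : Finset (Fin n)) : Submodule (ZMod 2) (Fin n → ZMod 2) where
  carrier := {x | x ∈ LinearMap.ker (boundary s t) ∧ ∀ e ∉ S, x e = 0}
  zero_mem' := by simp
  add_mem' := fun hx hy => ⟨add_mem hx.1 hy.1, fun e he => by simp [hx.2 e he, hy.2 e he]⟩
  smul_mem' := fun a x hx => ⟨Submodule.smul_mem _ a hx.1, fun e he => by simp [hx.2 e he]⟩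

open Classical in
/-- The vertices that are incident with an edge of `S`. -/
noncomputable def vertsOf (S : Finset (Fin n)) : Finset V :=
  (S ×ˢ (Finset.univ : Finset Bool)).image (dartTail s t)

open Classical in
/-- The darts of `S` that leave `v`. -/
noncomputable def dartsAt (S : Finset (Fin n)) (v : V) : Finset (Fin n × Bool) :=
  (S ×ˢ (Finset.univ : Finset Bool)).filter fun d => dartTail s t d = v

/-- A nonempty edge set whose cycle code has rate at least `R`, minimal with this property. -/
structure IsRateMinimal (R : ℝ) (S : Finset (Fin n)) : Prop where
  nonempty : S.Nonempty
  le_finrank : R * S.card ≤ Module.finrank (ZMod 2) (cyclesIn s t S)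
  finrank_lt : ∀ S', S' ⊂ S → S'.Nonempty →
    (Module.finrank (ZMod 2) (cyclesIn s t S') : ℝ) < R * S'.card

variable {s t} {R : ℝ} {S : Finset (Fin n)}

theorem cyclesIn_univ : cyclesIn s t Finset.univ = LinearMap.ker (boundary s t) := by
  ext x
  exact ⟨fun h => h.1, fun h => ⟨h, fun e he => absurd (Finset.mem_univ e) he⟩⟩

theorem cyclesIn_empty : cyclesIn s t ∅ = ⊥ := by
  rw [eq_bot_iff]
  intro x hx
  exact (Submodule.mem_bot _).2 (funext fun e => hx.2 e (Finset.notMem_empty e))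

theorem exists_isRateMinimal (hn : 0 < n)
    (h : R * n ≤ Module.finrank (ZMod 2) (LinearMap.ker (boundary s t))) :
    ∃ S, IsRateMinimal s t R S := by
  obtain ⟨S, hS⟩ := exists_minimal_of_wellFoundedLT (fun S : Finset (Fin n) => S.Nonempty ∧
    R * S.card ≤ Module.finrank (ZMod 2) (cyclesIn s t S)) ⟨Finset.univ,
      Finset.univ_nonempty_iff.2 ⟨⟨0, hn⟩⟩, by rw [cyclesIn_univ]; simpa using h⟩
  refine ⟨S, hS.prop.1, hS.prop.2, fun S' hS' hne => ?_⟩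
  by_contra! hcon
  exact hS'.2 (hS.le_of_le ⟨hne, hcon⟩ hS'.1)

theorem IsRateMinimal.finrank_le (hS : IsRateMinimal s t R S) {S' : Finset (Fin n)}
    (h : S' ⊂ S) : (Module.finrank (ZMod 2) (cyclesIn s t S') : ℝ) ≤ R * S'.card := by
  rcases S'.eq_empty_or_nonempty with rfl | hne
  · rw [cyclesIn_empty]; simp
  · exact (hS.finrank_lt S' h hne).le

/-- An edge at a vertex of degree one lies in no cycle, so deleting it would keep the dimension and
raise the rate. -/
theorem IsRateMinimal.two_le_card_dartsAt (hR : 0 < R) (hS : IsRateMinimal s t R S) {v : V}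
    (hv : v ∈ vertsOf s t S) : 2 ≤ (dartsAt s t S v).card := by
  classical
  obtain ⟨d, hd, hdv⟩ := Finset.mem_image.1 hv
  have hmem : d ∈ dartsAt s t S v := Finset.mem_filter.2 ⟨hd, hdv⟩
  have hdS : d.1 ∈ S := (Finset.mem_product.1 hd).1
  by_contra! hcon
  have huniq : ∀ d' ∈ dartsAt s t S v, d' = d := fun d' hd' =>
    Finset.card_le_one.1 (by omega) d' hd' d hmem
  have hle : cyclesIn s t S ≤ cyclesIn s t (S.erase d.1) := by
    rintro x ⟨hx, hxS⟩
    refine ⟨hx, fun e he => ?_⟩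
    by_cases heS : e ∈ S
    · have hed : e = d.1 := by
        by_contra hne
        exact he (Finset.mem_erase.2 ⟨hne, heS⟩)
      have := congrFun (LinearMap.mem_ker.1 hx) v
      rw [boundary_apply, Finset.sum_eq_single_of_mem d (by simpa using hdv)] at this
      · rw [hed]; exact this
      · intro d' hd' hne
        refine hxS _ fun hmem' => hne (huniq d' ?_)
        simp only [Finset.mem_filter, Finset.mem_univ, true_and] at hd'
        simp [dartsAt, hmem', hd']
    · exact hxS e heS
  have h1 := hS.finrank_le (Finset.erase_ssubset hdS)
  have h2 : (Module.finrank (ZMod 2) (cyclesIn s t S) : ℝ) ≤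
      Module.finrank (ZMod 2) (cyclesIn s t (S.erase d.1)) := by
    exact_mod_cast Submodule.finrank_mono hle
  have h3 := hS.le_finrank
  have h4 : ((S.erase d.1).card : ℝ) = S.card - 1 := by
    rw [Finset.card_erase_of_mem hdS, Nat.cast_sub hS.nonempty.card_pos]; simp
  rw [h4] at h1
  linarith

/-- A minimal edge set is connected: otherwise the cycle space would split over two parts, both of
rate below `R`. Hence the incidence matrix with one vertex removed has full rank. -/
theorem IsRateMinimal.card_vertsOf_add_finrank_le (hS : IsRateMinimal s t R S) :
    (vertsOf s t S).card + Module.finrank (ZMod 2) (cyclesIn s t S) ≤ S.card + 1 := by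
  classical
  have hsv : ∀ e ∈ S, s e ∈ vertsOf s t S := fun e he =>
    Finset.mem_image.2 ⟨(e, true), by simp [he], rfl⟩
  obtain ⟨e₀, he₀⟩ := hS.nonempty
  set W := (vertsOf s t S).erase (s e₀) with hW
  let M : Matrix S W (ZMod 2) := fun e w =>
    (if s e = w then 1 else 0) + (if t e = w then 1 else 0)
  have hinj : Function.Injective M.mulVecLin := by
    rw [injective_iff_map_eq_zero]
    intro φ hφ
    by_contra hne
    obtain ⟨w, hw⟩ := Function.ne_iff.1 hne
    let f : V → ZMod 2 := fun v => if h : v ∈ W then φ ⟨v, h⟩ else 0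
    have hf : ∀ v : V, ∑ w : W, (if v = (w : V) then 1 else 0) * φ w = f v := by
      intro v
      by_cases h : v ∈ W
      · rw [Finset.sum_eq_single (⟨v, h⟩ : W)]
        · simp [f, h]
        · intro b _ hb
          rw [if_neg, zero_mul]
          rintro rfl
          exact hb rfl
        · simp
      · simp only [f, h, dite_false]
        refine Finset.sum_eq_zero fun b _ => ?_
        rw [if_neg, zero_mul]
        rintro rfl
        exact h b.2
    -- A kernel vector is constant along edges. Its support therefore separates `S` into two parts
    -- without common vertices; it misses `s e₀` and contains `w`, so both parts are proper.
    have hst : ∀ e ∈ S, f (s e) = f (t e) := by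
      intro e he
      have : ∑ w : W, ((if s e = (w : V) then 1 else 0) + (if t e = (w : V) then 1 else 0)) * φ w =
          0 := congrFun hφ ⟨e, he⟩
      simp only [add_mul, Finset.sum_add_distrib, hf] at this
      exact CharTwo.add_eq_zero.1 this
    set S₁ := S.filter fun e => f (s e) ≠ 0 with hS₁
    set S₀ := S.filter fun e => ¬ f (s e) ≠ 0 with hS₀
    have hcard : S₁.card + S₀.card = S.card := Finset.card_filter_add_card_filter_not _
    have h1 : S₁ ⊂ S := by
      refine Finset.filter_ssubset.2 ⟨e₀, he₀, ?_⟩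
      simp [f, hW]
    have h0 : S₀ ⊂ S := by
      obtain ⟨d, hd, hdw⟩ := Finset.mem_image.1 (Finset.mem_of_mem_erase w.2)
      have hdS := (Finset.mem_product.1 hd).1
      refine Finset.filter_ssubset.2 ⟨d.1, hdS, ?_⟩
      have hfw : f w ≠ 0 := by simpa [f] using hw
      unfold dartTail at hdw
      rw [not_not]
      split_ifs at hdw
      · rwa [hdw]
      · rwa [hst _ hdS, hdw]
    have hsup : cyclesIn s t S ≤ cyclesIn s t S₁ ⊔ cyclesIn s t S₀ := by
      rintro x ⟨hx, hxS⟩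
      set y : Fin n → ZMod 2 := fun e => if f (s e) ≠ 0 then x e else 0 with hy
      have hyker : y ∈ LinearMap.ker (boundary s t) := by
        rw [LinearMap.mem_ker]
        ext v
        have e1 : boundary s t y v = if f v ≠ 0 then boundary s t x v else 0 := by
          have e2 : ∀ d, dartTail s t d = v → y d.1 = if f v ≠ 0 then x d.1 else 0 := by
            intro d hd
            by_cases hdS : d.1 ∈ S
            · have : f (s d.1) = f v := by
                unfold dartTail at hd
                split_ifs at hd
                · rw [hd]
                · rw [hst _ hdS, hd]
              simp only [hy, this]
            · simp [hy, hxS _ hdS]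
          rw [boundary_apply, boundary_apply, Finset.sum_congr rfl fun d hd =>
            e2 d (Finset.mem_filter.1 hd).2]
          split_ifs <;> simp
        rw [e1, LinearMap.mem_ker.1 hx]
        simp
      refine Submodule.mem_sup.2 ⟨y, ⟨hyker, fun e he => ?_⟩, x - y,
        ⟨sub_mem hx hyker, fun e he => ?_⟩, by abel⟩
      · by_cases heS : e ∈ S
        · simp [hS₁, heS] at he
          simp [hy, he]
        · simp [hy, hxS e heS]
      · by_cases heS : e ∈ S
        · simp [hS₀, heS] at he
          simp [hy, he]
        · simp [hy, hxS e heS]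
    have hle : Module.finrank (ZMod 2) (cyclesIn s t S) ≤
        Module.finrank (ZMod 2) (cyclesIn s t S₁) + Module.finrank (ZMod 2) (cyclesIn s t S₀) :=
      (Submodule.finrank_mono hsup).trans (Submodule.finrank_add_le_finrank_add_finrank _ _)
    have hc1 := Finset.card_lt_card h1
    have hc0 := Finset.card_lt_card h0
    have i1 := hS.finrank_lt _ h1 (Finset.card_pos.1 (by omega))
    have i0 := hS.finrank_lt _ h0 (Finset.card_pos.1 (by omega))
    have i2 := hS.le_finrank
    have i3 : (Module.finrank (ZMod 2) (cyclesIn s t S) : ℝ) ≤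
        Module.finrank (ZMod 2) (cyclesIn s t S₁) + Module.finrank (ZMod 2) (cyclesIn s t S₀) := by
      exact_mod_cast hle
    have i4 : (S₁.card : ℝ) + S₀.card = S.card := by exact_mod_cast hcard
    rw [← i4] at i2
    linarith
  have hrank : M.transpose.rank = W.card := by
    rw [Matrix.rank_transpose, Matrix.rank, LinearMap.finrank_range_of_inj hinj]
    simp
  have hdim := LinearMap.finrank_range_add_finrank_ker M.transpose.mulVecLin
  rw [← Matrix.rank, hrank, Module.finrank_fintype_fun_eq_card, Fintype.card_coe] at hdim
  let r : cyclesIn s t S →ₗ[ZMod 2] LinearMap.ker M.transpose.mulVecLin :=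
    { toFun := fun x => ⟨fun e => x.1 e, by
        rw [LinearMap.mem_ker]
        ext w
        have := congrFun (LinearMap.mem_ker.1 x.2.1) w
        refine Eq.trans ?_ this
        change ∑ e : S, ((if s e = (w : V) then 1 else 0) + (if t e = (w : V) then 1 else 0)) *
          x.1 e = ∑ e, x.1 e * ((if s e = (w : V) then 1 else 0) + (if t e = (w : V) then 1 else 0))
        rw [← Finset.sum_subset (Finset.subset_univ S)
          (fun e _ he => by rw [x.2.2 e he, zero_mul]), ← Finset.sum_coe_sort S]
        exact Finset.sum_congr rfl fun e _ => mul_comm _ _⟩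
      map_add' := fun x y => rfl
      map_smul' := fun a x => rfl }
  have hr : Function.Injective r := by
    intro x y hxy
    ext e
    by_cases he : e ∈ S
    · exact congrFun (congrArg Subtype.val hxy) ⟨e, he⟩
    · rw [x.2.2 e he, y.2.2 e he]
  have := LinearMap.finrank_le_finrank_of_injective hr
  have hWc : W.card + 1 = (vertsOf s t S).card := Finset.card_erase_add_one (hsv e₀ he₀)
  omega

end

/-! ### Growth of non-backtracking walks -/

section
variable {V : Type} {n : ℕ} {s t : Fin n → V} {R : ℝ} {S : Finset (Fin n)}

theorem dartRev_dartRev (d : Fin n × Bool) : dartRev (dartRev d) = d := by simp [dartRev]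

theorem dartTail_dartRev (d : Fin n × Bool) : dartTail s t (dartRev d) = dartHead s t d := by
  unfold dartRev dartTail dartHead; cases d.2 <;> simp

theorem dartHead_dartRev (d : Fin n × Bool) : dartHead s t (dartRev d) = dartTail s t d := by
  unfold dartRev dartTail dartHead; cases d.2 <;> simp

theorem sum_card_dartsAt : ∑ v ∈ vertsOf s t S, (dartsAt s t S v).card = 2 * S.card := by
  classical
  have := Finset.card_eq_sum_card_fiberwise (f := dartTail s t)
    (s := S ×ˢ (Finset.univ : Finset Bool)) (t := vertsOf s t S)
    fun d hd => Finset.mem_image_of_mem _ hd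
  rw [Finset.card_product] at this
  simp only [Finset.card_univ, Fintype.card_bool] at this
  unfold dartsAt
  omega

/-- In a graph of minimum degree at least two, the growth rate of non-backtracking walks is at
least the weighted geometric mean of the numbers of continuations. -/
theorem exists_superharmonic_darts (hne : S.Nonempty)
    (hdeg : ∀ v ∈ vertsOf s t S, 2 ≤ (dartsAt s t S v).card) {l : ℝ} (hl : 0 < l)
    (h : 2 * S.card * Real.log l ≤ ∑ v ∈ vertsOf s t S,
      (dartsAt s t S v).card * Real.log ((dartsAt s t S v).card - 1)) :
    ∃ x : Fin n × Bool → ℝ, (∀ d, 0 ≤ x d) ∧ (∀ d, x d ≤ 1) ∧ (∃ d, x d = 1) ∧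
      ∀ d, l * x d ≤ ∑ d' ∈ nextDarts s t d, x d' := by
  classical
  let ι := {d : Fin n × Bool // d ∈ S ×ˢ (Finset.univ : Finset Bool)}
  have hι : ∀ i : ι, i.1.1 ∈ S := fun i => (Finset.mem_product.1 i.2).1
  have : Nonempty ι := hne.elim fun e he => ⟨⟨(e, true), by simp [he]⟩⟩
  let rev : ι ≃ ι :=
    { toFun := fun i => ⟨dartRev i.1, by simp [dartRev, hι i]⟩
      invFun := fun i => ⟨dartRev i.1, by simp [dartRev, hι i]⟩
      left_inv := fun i => Subtype.ext (dartRev_dartRev _)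
      right_inv := fun i => Subtype.ext (dartRev_dartRev _) }
  let next : ι → Finset ι := fun i =>
    Finset.univ.filter fun j => dartTail s t j.1 = dartHead s t i.1 ∧ j ≠ rev i
  have hcard : ∀ i : ι, (next i).card + 1 = (dartsAt s t S (dartHead s t i.1)).card := by
    intro i
    have hmem : dartRev i.1 ∈ dartsAt s t S (dartHead s t i.1) :=
      Finset.mem_filter.2 ⟨(rev i).2, dartTail_dartRev _⟩
    rw [← Finset.card_erase_add_one hmem]
    congr 1
    refine Finset.card_bij (fun j _ => j.1) ?_ (fun _ _ _ _ h => Subtype.ext h) ?_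
    · intro j hj
      simp only [next, Finset.mem_filter, Finset.mem_univ, true_and] at hj
      exact Finset.mem_erase.2 ⟨fun h => hj.2 (Subtype.ext h), Finset.mem_filter.2 ⟨j.2, hj.1⟩⟩
    · intro d hd
      obtain ⟨h1, h2⟩ := Finset.mem_erase.1 hd
      obtain ⟨h3, h4⟩ := Finset.mem_filter.1 h2
      exact ⟨⟨d, h3⟩, by
        simp only [next, Finset.mem_filter, Finset.mem_univ, true_and]
        exact ⟨h4, fun h => h1 (congrArg Subtype.val h)⟩, rfl⟩
  have hverts : ∀ i : ι, dartHead s t i.1 ∈ vertsOf s t S := fun i =>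
    Finset.mem_image.2 ⟨(rev i).1, (rev i).2, dartTail_dartRev _⟩
  have hpos : ∀ i, 0 < (next i).card := fun i => by
    have := hdeg _ (hverts i)
    have := hcard i
    omega
  -- Reversal maps the predecessors of `j` onto the successors of `rev j`. All predecessors end at
  -- the same vertex, hence have equally many successors.
  have hbal : ∀ j, ∑ i with j ∈ next i, 1 / ((next i).card : ℝ) = 1 := by
    intro j
    have hc : ∀ i, j ∈ next i → (next i).card = (next (rev j)).card := by
      intro i hi
      simp only [next, Finset.mem_filter, Finset.mem_univ, true_and] at hi
      have h1 := hcard i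
      have h2 := hcard (rev j)
      rw [← hi.1] at h1
      rw [show dartHead s t (rev j).1 = dartTail s t j.1 from dartHead_dartRev _] at h2
      omega
    rw [Finset.sum_congr rfl fun i hi => by rw [hc i (Finset.mem_filter.1 hi).2], Finset.sum_const,
      nsmul_eq_mul]
    have : (Finset.univ.filter fun i => j ∈ next i).card = (next (rev j)).card := by
      refine Finset.card_equiv rev fun i => ?_
      simp only [next, Finset.mem_filter, Finset.mem_univ, true_and]
      rw [show dartTail s t (rev i).1 = dartHead s t i.1 from dartTail_dartRev _,
        show dartHead s t (rev j).1 = dartTail s t j.1 from dartHead_dartRev _]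
      rw [show rev (rev j) = j from rev.left_inv j]
      exact and_congr eq_comm (not_congr eq_comm)
    rw [this, mul_one_div_cancel]
    exact_mod_cast (hpos (rev j)).ne'
  obtain ⟨x, hx0, hx1, ⟨i₀, hi₀⟩, hx⟩ := exists_superharmonic_of_sum_log_le next
    (fun i => Finset.card_pos.1 (hpos i)) hbal hl (by
      have e1 : (Fintype.card ι : ℝ) = 2 * S.card := by
        rw [Fintype.card_coe, Finset.card_product]
        simp [mul_comm]
      have e2 : ∑ i, Real.log (next i).card = ∑ v ∈ vertsOf s t S,
          (dartsAt s t S v).card * Real.log ((dartsAt s t S v).card - 1) := by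
        have e3 : ∀ i, Real.log (next i).card =
            Real.log ((dartsAt s t S (dartTail s t (rev i).1)).card - 1) := by
          intro i
          rw [show dartTail s t (rev i).1 = dartHead s t i.1 from dartTail_dartRev _, ← hcard i]
          simp
        rw [Finset.sum_congr rfl fun i _ => e3 i, Equiv.sum_comp rev fun i : ι =>
          Real.log ((dartsAt s t S (dartTail s t i.1)).card - 1),
          Finset.sum_coe_sort (S ×ˢ (Finset.univ : Finset Bool)) fun d =>
            Real.log ((dartsAt s t S (dartTail s t d)).card - 1),
          ← Finset.sum_fiberwise_of_maps_to (g := dartTail s t) (t := vertsOf s t S)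
            fun d hd => Finset.mem_image_of_mem _ hd]
        refine Finset.sum_congr rfl fun v _ => ?_
        rw [Finset.sum_congr rfl fun d hd => by rw [(Finset.mem_filter.1 hd).2], Finset.sum_const,
          nsmul_eq_mul]
        rfl
      rw [e1, e2]
      exact h)
  refine ⟨fun d => if hd : d ∈ S ×ˢ (Finset.univ : Finset Bool) then x ⟨d, hd⟩ else 0,
    fun d => ?_, fun d => ?_, ⟨i₀.1, ?_⟩, fun d => ?_⟩
  · dsimp only; split_ifs
    exacts [hx0 _, le_rfl]
  · dsimp only; split_ifs
    exacts [hx1 _, zero_le_one]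
  · exact (dif_pos i₀.2).trans hi₀
  · have hnn : ∀ d' : Fin n × Bool, 0 ≤
        if hd : d' ∈ S ×ˢ (Finset.univ : Finset Bool) then x ⟨d', hd⟩ else 0 := by
      intro d'; split_ifs
      exacts [hx0 _, le_rfl]
    by_cases hd : d ∈ S ×ˢ (Finset.univ : Finset Bool)
    · dsimp only
      rw [dif_pos hd]
      refine (hx ⟨d, hd⟩).trans ?_
      calc ∑ j ∈ next ⟨d, hd⟩, x j = ∑ j ∈ (next ⟨d, hd⟩).map (Function.Embedding.subtype _),
            (if hd : j ∈ S ×ˢ (Finset.univ : Finset Bool) then x ⟨j, hd⟩ else 0) := by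
            rw [Finset.sum_map]
            refine Finset.sum_congr rfl fun j _ => ?_
            change x j = if hd : j.1 ∈ S ×ˢ (Finset.univ : Finset Bool) then x ⟨j.1, hd⟩ else 0
            rw [dif_pos j.2]
        _ ≤ _ := by
            refine Finset.sum_le_sum_of_subset_of_nonneg ?_ fun d' _ _ => hnn d'
            intro d' hd'
            obtain ⟨j, hj, rfl⟩ := Finset.mem_map.1 hd'
            simp only [next, Finset.mem_filter, Finset.mem_univ, true_and] at hj
            simp only [nextDarts, Finset.mem_filter, Finset.mem_univ, true_and]
            exact ⟨hj.1, fun h => hj.2 (Subtype.ext h)⟩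
    · dsimp only
      rw [dif_neg hd, mul_zero]
      exact Finset.sum_nonneg fun d' _ => hnn d'

end

/-! ### From graphs to a uniform lower bound -/

open Classical in
-- The right side is at least the probability that every bit on the support of `c` is in error.
theorem pow_le_sum_undecodable {p : ℝ} (h0 : 0 ≤ p) (h1 : p ≤ 1) {n : ℕ}
    {C : Submodule (ZMod 2) (Fin n → ZMod 2)} {c : Fin n → ZMod 2} (hc : c ∈ C) (hne : c ≠ 0) :
    p ^ hammingNorm c ≤ ∑ x, (if Undecodable C x then (1 : ℝ) else 0) * bscProb p 0 x := by
  let f : Fin n → ZMod 2 → ℝ := fun i a =>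
    if c i ≠ 0 ∧ a = 0 then 0 else if a = 0 then 1 - p else p
  have h2 : ∀ g : ZMod 2 → ℝ, ∑ a, g a = g 0 + g 1 := fun g => Fin.sum_univ_two g
  have hf : ∀ i, ∑ a, f i a = if c i ≠ 0 then p else 1 := by
    intro i
    rw [h2]
    by_cases h : c i = 0 <;> simp [f, h]
  calc p ^ hammingNorm c = ∏ i, ∑ a, f i a := by
        simp only [hf, hammingNorm]
        rw [Finset.prod_ite]
        simp
    _ = ∑ x : Fin n → ZMod 2, ∏ i, f i (x i) := by
        rw [Finset.prod_univ_sum, Fintype.piFinset_univ]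
    _ ≤ _ := by
        refine Finset.sum_le_sum fun x _ => ?_
        have hnn := bscProb_nonneg h0 h1 0 x
        by_cases h : ∃ i, c i ≠ 0 ∧ x i = 0
        · obtain ⟨i, hi⟩ := h
          rw [Finset.prod_eq_zero (Finset.mem_univ i) (by simp only [f]; rw [if_pos hi])]
          split_ifs <;> simp [hnn]
        · push Not at h
          rw [if_pos, one_mul]
          · refine le_of_eq (Finset.prod_congr rfl fun i _ => ?_)
            simp only [f]
            rw [if_neg fun hi => h i hi.1 hi.2]
            rfl
          · refine undecodable_of_sum_errorSign hc hne (Finset.sum_nonneg fun i _ => ?_)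
            split_ifs with hi
            · exact le_rfl
            · simp [errorSign, h i hi]

/-- A loop enters `boundary` with coefficient `1 + 1 = 0`, in accordance with its even contribution
to the degree. -/
theorem exists_cycleSpace_eq_ker_boundary {V : Type} {n : ℕ} (G : Graph V (Fin n))
    (hG : G.edgeSet = Set.univ) :
    ∃ s t : Fin n → V, cycleSpace G = LinearMap.ker (boundary s t) := by
  classical
  have hlink : ∀ e, ∃ x y, G.IsLink e x y := fun e =>
    Graph.exists_isLink_of_mem_edgeSet (hG ▸ Set.mem_univ e)
  choose s t hst using hlink
  refine ⟨s, t, ?_⟩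
  ext x
  have hb : ∀ v, boundary s t x v = ∑ e with G.IsNonloopAt e v, x e := by
    intro v
    change ∑ e, x e * ((if s e = v then 1 else 0) + (if t e = v then 1 else 0)) = _
    rw [Finset.sum_filter]
    refine Finset.sum_congr rfl fun e _ => ?_
    have hiff : G.IsNonloopAt e v ↔ s e ≠ t e ∧ (s e = v ∨ t e = v) := by
      simp only [Graph.IsNonloopAt, (hst e).isLink_iff]
      constructor
      · rintro ⟨y, hy, ⟨h1, h2⟩ | ⟨h1, h2⟩⟩
        · exact ⟨by rw [h1, h2]; exact hy.symm, Or.inl h1⟩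
        · exact ⟨by rw [h1, h2]; exact hy, Or.inr h2⟩
      · rintro ⟨hne, h1 | h1⟩
        · exact ⟨t e, fun h => hne (h1.trans h.symm), Or.inl ⟨h1, rfl⟩⟩
        · exact ⟨s e, fun h => hne (h.trans h1.symm), Or.inr ⟨rfl, h1⟩⟩
    by_cases h1 : s e = v <;> by_cases h2 : t e = v <;> simp [hiff, h1, h2]
    · exact Or.inr (CharTwo.add_self_eq_zero _)
    · exact fun h => absurd h.symm h2
  rw [LinearMap.mem_ker]
  change IsEvenEdgeSet G (wordSupport x) ↔ _
  constructor
  · rintro ⟨-, h⟩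
    ext v
    by_cases hv : v ∈ G.vertexSet
    · rw [hb]; exact (even_degreeIn_wordSupport G x v).1 (h v hv)
    · rw [hb]
      refine Finset.sum_eq_zero fun e he => absurd (Finset.mem_filter.1 he).2.vertex_mem hv
  · intro h
    refine ⟨fun e _ => hG ▸ Set.mem_univ e, fun v _ => ?_⟩
    rw [even_degreeIn_wordSupport, ← hb, h]
    rfl

/-- If `d * log (d - 1)` lies above the line `a * d - b`, then cycle codes of rate at least `R`
have error probability bounded below beyond the corresponding bit-error rate. -/
theorem exists_le_mlErrorProb_cycleCodes {R p a b : ℝ} (hR : 0 < R) (hp0 : 0 < p)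
    (hp1 : p < 1 / 2) (hb : 0 ≤ b)
    (hline : ∀ d : ℕ, 2 ≤ d → a * d - b ≤ d * Real.log (d - 1))
    (hgrow : 1 < 4 * p * (1 - p) * Real.exp (a - b * (1 - R) / 2) ^ 2) :
    ∃ ε > 0, ∀ C ∈ cycleCodes, R ≤ C.rate → ε ≤ mlErrorProb p C := by
  classical
  set h := a - b * (1 - R) / 2 with hh
  have hq : 0 < 4 * p * (1 - p) := by nlinarith
  have hq1 : 4 * p * (1 - p) ≤ 1 := by nlinarith [sq_nonneg (1 - 2 * p)]
  -- In `w < γ < l < exp h`, the first gap makes blocks succeed often enough, the second drives the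
  -- branching, and the third absorbs the additive constant in the vertex count.
  set w := √(1 / (4 * p * (1 - p))) with hw
  have hw1 : 1 ≤ w := Real.one_le_sqrt.2 ((le_div_iff₀ hq).2 (by linarith))
  have hwm : w < Real.exp h := by
    rw [hw, Real.sqrt_lt' (Real.exp_pos h), div_lt_iff₀ hq]
    linarith
  obtain ⟨γ, hγw, hγm⟩ := exists_between hwm
  obtain ⟨l, hγl, hlm⟩ := exists_between hγm
  have hγ1 : 1 ≤ γ := hw1.trans hγw.le
  have hl0 : 0 < l := by linarith
  obtain ⟨T, hT, hT1⟩ := exists_one_le_tailWeight hp0 (by linarith) hγ1 (by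
    have : √(1 / (4 * p * (1 - p))) < γ := hγw
    rw [Real.sqrt_lt' (by linarith), div_lt_iff₀ hq] at this
    linarith)
  have hlog : 0 < h - Real.log l := by
    have := Real.log_lt_log hl0 hlm
    rw [Real.log_exp] at this
    linarith
  have hTpos : (0 : ℝ) < T := by exact_mod_cast hT
  -- The first bound on `g` is the collision condition for `K = T + 1` and `α = 1 / T`. The second
  -- makes `S` so large that the `+ 1` in the vertex count costs no more than the gap between `log
  -- l` and `h`.
  obtain ⟨g, hg⟩ := exists_nat_ge (max ((T : ℝ) * (4 * (T + 1) + 1) + 1) (b / (2 * (h - Real.log l))))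
  have hgK : 4 * ((T : ℝ) + 1) + 1 ≤ 1 / T * (g - 1) := by
    have := (le_max_left _ _).trans hg
    rw [one_div, ← div_eq_inv_mul, le_div_iff₀ hTpos]
    linarith
  have hgb : b ≤ g * (2 * (h - Real.log l)) := by
    have := (le_max_right _ _).trans hg
    rwa [div_le_iff₀ (by linarith)] at this
  set κ := (l - γ) / (l * γ * γ ^ T) with hκ
  have hκ0 : 0 < κ := div_pos (by linarith) (by positivity)
  refine ⟨min κ (p ^ g), lt_min hκ0 (pow_pos hp0 g), fun C hC hrate => ?_⟩
  obtain ⟨V, _, G, hG, hwords⟩ := hC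
  obtain ⟨s, t, hst⟩ := exists_cycleSpace_eq_ker_boundary G hG
  rw [hst] at hwords
  rw [mlErrorProb_eq_sum hp0 hp1, hwords]
  by_cases hgirth : ∀ c ∈ LinearMap.ker (boundary s t), c ≠ 0 → g ≤ hammingNorm c
  swap
  · push Not at hgirth
    obtain ⟨c, hc, hne, hlt⟩ := hgirth
    exact (min_le_right _ _).trans ((pow_le_pow_of_le_one hp0.le (by linarith) hlt.le).trans
      (pow_le_sum_undecodable hp0.le (by linarith) hc hne))
  refine (min_le_left _ _).trans ?_
  have hlen : 0 < C.length := by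
    rcases Nat.eq_zero_or_pos C.length with h0 | h0
    · have h1 : (C.length : ℝ) = 0 := by exact_mod_cast h0
      rw [rate, h1, div_zero] at hrate
      linarith
    · exact h0
  have hlen' : (0 : ℝ) < C.length := by exact_mod_cast hlen
  rw [rate, le_div_iff₀ hlen', hwords] at hrate
  obtain ⟨S, hS⟩ := exists_isRateMinimal hlen hrate
  have hSpos : (0 : ℝ) < S.card := by exact_mod_cast hS.nonempty.card_pos
  have hgS : g ≤ S.card := by
    -- Positive rate forces a nonzero cycle inside `S`, of length at least `g`.
    have : 0 < Module.finrank (ZMod 2) (cyclesIn s t S) := by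
      have := hS.le_finrank
      have h2 : (0 : ℝ) < R * S.card := by positivity
      exact_mod_cast h2.trans_le this
    obtain ⟨x, hx⟩ := Module.finrank_pos_iff_exists_ne_zero.1 this
    refine (hgirth x.1 x.2.1 fun h => hx (Subtype.ext h)).trans ?_
    refine Finset.card_le_card fun e he => ?_
    by_contra hcon
    exact (Finset.mem_filter.1 he).2 (x.2.2 e hcon)
  have hsum : 2 * S.card * Real.log l ≤ ∑ v ∈ vertsOf s t S,
      (dartsAt s t S v).card * Real.log ((dartsAt s t S v).card - 1) := by
    have e1 : ∑ v ∈ vertsOf s t S, (a * (dartsAt s t S v).card - b) =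
        a * (2 * S.card) - b * (vertsOf s t S).card := by
      rw [Finset.sum_sub_distrib, ← Finset.mul_sum, Finset.sum_const, nsmul_eq_mul, mul_comm b]
      congr 2
      exact_mod_cast sum_card_dartsAt (s := s) (t := t) (S := S)
    refine le_trans ?_ (Finset.sum_le_sum fun v hv =>
      hline _ (hS.two_le_card_dartsAt hR hv))
    rw [e1]
    have e2 : ((vertsOf s t S).card : ℝ) + Module.finrank (ZMod 2) (cyclesIn s t S) ≤
        S.card + 1 := by exact_mod_cast hS.card_vertsOf_add_finrank_le
    have e3 := hS.le_finrank
    have e4 : b * (vertsOf s t S).card ≤ b * (S.card * (1 - R) + 1) :=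
      mul_le_mul_of_nonneg_left (by linarith) hb
    have e5 : b ≤ S.card * (2 * (h - Real.log l)) := hgb.trans
      (mul_le_mul_of_nonneg_right (by exact_mod_cast hgS) (by linarith))
    rw [hh] at e5
    linarith
  obtain ⟨x, hx0, hx1, ⟨d₀, hd₀⟩, hx⟩ := exists_superharmonic_darts hS.nonempty
    (fun v hv => hS.two_le_card_dartsAt hR hv) hl0 hsum
  refine le_errorProb_of_growth (blockPotential hp0.le (by linarith) hγ1 hT hT1) hp0.le
    (by linarith) hγ1 (by positivity) hgK hgirth hx0 hx1 hγl hx hκ0.le ?_ hd₀ (s₀ := (T, 1)) ?_ ?_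
  · rw [hκ]
    apply le_of_eq
    field_simp
  · exact ⟨le_rfl, by simp, fun h => absurd h hT.ne'⟩
  · exact hT1

/-! ### Convexity in the degree -/

theorem hasDerivAt_mul_log_sub_one {x : ℝ} (hx : 1 < x) :
    HasDerivAt (fun x => x * Real.log (x - 1)) (Real.log (x - 1) + x / (x - 1)) x := by
  have h1 : HasDerivAt (fun x : ℝ => x - 1) 1 x := (hasDerivAt_id x).sub_const 1
  have h2 := (hasDerivAt_id x).mul (h1.log (by linarith))
  exact h2.congr_deriv (by simp [div_eq_mul_inv])

/-- The second derivative is `(x - 2) / (x - 1) ^ 2`, hence the need for minimum degree two. -/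
theorem strictConvexOn_mul_log_sub_one :
    StrictConvexOn ℝ (Set.Ici 2) fun x : ℝ => x * Real.log (x - 1) := by
  refine StrictMonoOn.strictConvexOn_of_deriv (convex_Ici 2) (fun x hx =>
    (hasDerivAt_mul_log_sub_one (by linarith [Set.mem_Ici.1 hx])).continuousAt.continuousWithinAt) ?_
  rw [interior_Ici]
  intro x hx y hy hxy
  rw [Set.mem_Ioi] at hx hy
  rw [(hasDerivAt_mul_log_sub_one (by linarith)).deriv,
    (hasDerivAt_mul_log_sub_one (by linarith)).deriv]
  have h1 : 0 < x - 1 := by linarith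
  have h2 : 0 < y - 1 := by linarith
  have h3 := Real.log_le_sub_one_of_pos (div_pos h1 h2)
  rw [Real.log_div h1.ne' h2.ne'] at h3
  have h4 : y / (y - 1) - x / (x - 1) - ((x - 1) / (y - 1) - 1) =
      (y - x) * (x - 2) / ((x - 1) * (y - 1)) := by
    field_simp
    ring
  have h5 : 0 < (y - x) * (x - 2) / ((x - 1) * (y - 1)) :=
    div_pos (mul_pos (by linarith) (by linarith)) (mul_pos h1 h2)
  linarith

/-- The tangent of `x * log (x - 1)` at `x₀` lies strictly below the graph elsewhere. -/
theorem tangent_lt_mul_log_sub_one {x₀ x : ℝ} (h₀ : 2 < x₀) (hx : 2 ≤ x) (hne : x ≠ x₀) :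
    (Real.log (x₀ - 1) + x₀ / (x₀ - 1)) * x - x₀ ^ 2 / (x₀ - 1) < x * Real.log (x - 1) := by
  have hd := hasDerivAt_mul_log_sub_one (show 1 < x₀ by linarith)
  have e : (Real.log (x₀ - 1) + x₀ / (x₀ - 1)) * x - x₀ ^ 2 / (x₀ - 1) =
      x₀ * Real.log (x₀ - 1) + (Real.log (x₀ - 1) + x₀ / (x₀ - 1)) * (x - x₀) := by
    ring
  rw [e]
  rcases lt_or_gt_of_ne hne with h | h
  · have := strictConvexOn_mul_log_sub_one.slope_lt_of_hasDerivAt hx h₀.le h hd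
    rw [slope_def_field, div_lt_iff₀ (by linarith)] at this
    linarith
  · have := strictConvexOn_mul_log_sub_one.lt_slope_of_hasDerivAt h₀.le hx h hd
    rw [slope_def_field, lt_div_iff₀ (by linarith)] at this
    linarith

/-- At a non-integral point the tangent can be raised without crossing the graph at an integer. -/
theorem exists_tangent_add_le_mul_log_sub_one {x₀ : ℝ} (h₀ : 2 < x₀)
    (hint : ∀ d : ℕ, (d : ℝ) ≠ x₀) :
    ∃ η, 0 < η ∧ η ≤ 1 ∧ ∀ d : ℕ, 2 ≤ d →
      (Real.log (x₀ - 1) + x₀ / (x₀ - 1)) * d - (x₀ ^ 2 / (x₀ - 1) - η) ≤ d * Real.log (d - 1) := by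
  set F : ℝ → ℝ := fun x => x * Real.log (x - 1) +
    (-(Real.log (x₀ - 1) + x₀ / (x₀ - 1)) * x + x₀ ^ 2 / (x₀ - 1)) with hF
  have hconv : ConvexOn ℝ (Set.Ici 2) F := by
    refine strictConvexOn_mul_log_sub_one.convexOn.add ((LinearMap.convexOn
      (LinearMap.mulLeft ℝ (-(Real.log (x₀ - 1) + x₀ / (x₀ - 1)))) (convex_Ici 2)).add_const _)
  have hF0 : F x₀ = 0 := by simp only [hF]; ring
  have hpos : ∀ d : ℕ, 2 ≤ d → 0 < F d := by
    intro d hd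
    have := tangent_lt_mul_log_sub_one h₀ (show (2 : ℝ) ≤ d by exact_mod_cast hd) (hint d)
    simp only [hF]
    linarith
  set k := ⌊x₀⌋₊ with hk
  have hk2 : 2 ≤ k := Nat.le_floor (by exact_mod_cast h₀.le)
  have hkx : (k : ℝ) ≤ x₀ := Nat.floor_le (by linarith)
  have hxk : x₀ < k + 1 := Nat.lt_floor_add_one x₀
  -- By convexity the least gap at an integer occurs at a neighbour of `x₀`. The cap `1` later keeps
  -- the coefficient `b` nonnegative.
  refine ⟨min (min (F k) (F (k + 1 : ℕ))) 1, lt_min (lt_min (hpos k hk2) (hpos _ (by omega)))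
    one_pos, min_le_right _ _, fun d hd => ?_⟩
  have hd2 : (2 : ℝ) ≤ d := by exact_mod_cast hd
  have hle : min (min (F k) (F (k + 1 : ℕ))) 1 ≤ F d := by
    refine (min_le_left _ _).trans ?_
    rcases Nat.lt_or_ge k d with h | h
    · have hdk : ((k + 1 : ℕ) : ℝ) ≤ d := by exact_mod_cast h
      have := hconv.le_max_of_mem_Icc (x := x₀) (y := d) (z := (k + 1 : ℕ)) h₀.le hd2
        ⟨by push_cast; exact hxk.le, hdk⟩
      rw [hF0, max_eq_right (hpos d hd).le] at this
      exact (min_le_right _ _).trans this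
    · have hdk : (d : ℝ) ≤ k := by exact_mod_cast h
      have := hconv.le_max_of_mem_Icc (x := (d : ℝ)) (y := x₀) (z := (k : ℝ)) hd2 h₀.le ⟨hdk, hkx⟩
      rw [hF0, max_eq_left (hpos d hd).le] at this
      exact (min_le_left _ _).trans this
  simp only [hF] at hle
  linarith

theorem mlThreshold_le {𝒞 : Set BinaryCode} {R p : ℝ} (hp0 : 0 < p)
    (h : ∃ ε > 0, ∀ C ∈ 𝒞, R ≤ C.rate → ε ≤ mlErrorProb p C) : mlThreshold 𝒞 R ≤ p := by
  by_contra! hcon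
  obtain ⟨ε, hε, hC⟩ := h
  obtain ⟨C, hmem, hR, hle⟩ :=
    (isMLThreshold_mlThreshold 𝒞 R).2.1 p ⟨hp0, hcon⟩ (ε / 2) (half_pos hε)
  linarith [hC C hmem hR]

end BinaryCode

/-! ### The bound and the case of equality -/

open BinaryCode in
theorem theorem1 (R : ℝ) (hR0 : 0 < R) (hR1 : R < 1) :
    BinaryCode.mlThreshold BinaryCode.cycleCodes R ≤ (1 - √R) ^ 2 / (2 * (1 + R)) ∧
      (BinaryCode.mlThreshold BinaryCode.cycleCodes R = (1 - √R) ^ 2 / (2 * (1 + R)) →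
        ∃ d : ℤ, R = 1 - 2 / (d : ℝ)) := by
  set P := (1 - √R) ^ 2 / (2 * (1 + R)) with hP
  have hsq : √R ^ 2 = R := Real.sq_sqrt hR0.le
  have hs0 : 0 < √R := Real.sqrt_pos.2 hR0
  have hs1 : √R < 1 := by rw [Real.sqrt_lt' one_pos]; simpa using hR1
  have hP0 : 0 < P := div_pos (by have : 0 < 1 - √R := by linarith
                                  positivity) (by linarith)
  have hP1 : P < 1 / 2 := by
    rw [hP, div_lt_div_iff₀ (by linarith) two_pos]
    nlinarith
  have hPeq : 4 * P * (1 - P) = ((1 - R) / (1 + R)) ^ 2 := by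
    have : 1 - 2 * P = 2 * √R / (1 + R) := by
      rw [hP]; field_simp; linear_combination (-1 : ℝ) * hsq
    have e : 4 * P * (1 - P) = 1 - (1 - 2 * P) ^ 2 := by ring
    rw [e, this, div_pow, div_pow, mul_pow, hsq]
    field_simp
    ring
  -- The asymptotic average degree at rate `R`; a regular graph of this degree has non-backtracking
  -- growth `x₀ - 1`.
  set x₀ := 2 / (1 - R) with hx₀
  have h1R : 0 < 1 - R := by linarith
  have hx2 : 2 < x₀ := by rw [hx₀, lt_div_iff₀ h1R]; linarith
  have hx1 : x₀ - 1 = (1 + R) / (1 - R) := by rw [hx₀]; field_simp; ring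
  have hxpos : 0 < x₀ - 1 := by linarith
  have hb4 : 1 ≤ x₀ ^ 2 / (x₀ - 1) := by rw [le_div_iff₀ hxpos]; nlinarith
  have hxR : (1 - R) / 2 = 1 / x₀ := by rw [hx₀]; field_simp
  -- On the tangent, the value at `x₀` divided by `x₀` is `log (x₀ - 1)`; raising the line by `η`
  -- adds `η / x₀` to the growth exponent.
  have hexp : ∀ η, Real.log (x₀ - 1) + x₀ / (x₀ - 1) - (x₀ ^ 2 / (x₀ - 1) - η) * (1 - R) / 2 =
      Real.log (x₀ - 1) + η / x₀ := by
    intro η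
    rw [mul_div_assoc, hxR]
    field_simp
    ring
  have hgr : ∀ p η : ℝ, 4 * p * (1 - p) * Real.exp (Real.log (x₀ - 1) + x₀ / (x₀ - 1) -
      (x₀ ^ 2 / (x₀ - 1) - η) * (1 - R) / 2) ^ 2 =
      4 * p * (1 - p) * ((1 + R) / (1 - R)) ^ 2 * Real.exp (η / x₀) ^ 2 := by
    intro p η
    rw [hexp, Real.exp_add, Real.exp_log hxpos, hx1]
    ring
  have hPone : 4 * P * (1 - P) * ((1 + R) / (1 - R)) ^ 2 = 1 := by
    rw [hPeq, ← mul_pow]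
    have : (1 - R) / (1 + R) * ((1 + R) / (1 - R)) = 1 := by field_simp
    rw [this, one_pow]
  refine ⟨?_, fun heq => ?_⟩
  · refine le_of_forall_gt_imp_ge_of_dense fun q hq => ?_
    obtain ⟨p, hPp, hp⟩ := exists_between (lt_min hq hP1)
    refine le_trans (mlThreshold_le (hP0.trans hPp) ?_) (hp.le.trans (min_le_left _ _))
    have hp2 : p < 1 / 2 := hp.trans_le (min_le_right _ _)
    refine exists_le_mlErrorProb_cycleCodes hR0 (hP0.trans hPp) hp2
      (a := Real.log (x₀ - 1) + x₀ / (x₀ - 1)) (b := x₀ ^ 2 / (x₀ - 1) - 0) (by linarith)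
      (fun d hd => ?_) ?_
    · rw [sub_zero]
      by_cases h : (d : ℝ) = x₀
      · rw [h]; apply le_of_eq; ring
      · exact (tangent_lt_mul_log_sub_one hx2 (by exact_mod_cast hd) h).le
    · have hlt : 4 * P * (1 - P) < 4 * p * (1 - p) := by nlinarith
      have hpos : 0 < ((1 + R) / (1 - R)) ^ 2 := by positivity
      have := mul_lt_mul_of_pos_right hlt hpos
      rw [hPone] at this
      rw [hgr]
      simpa using this
  · by_contra! hne
    have hint : ∀ d : ℕ, (d : ℝ) ≠ x₀ := by
      intro d hd
      refine hne d ?_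
      rw [Int.cast_natCast, hd, hx₀]
      field_simp
      ring
    obtain ⟨η, hη0, hη1, hη⟩ := exists_tangent_add_le_mul_log_sub_one hx2 hint
    -- The factor gained from `η` makes the growth condition strict at `P`, so by continuity it
    -- persists at some `p < P`.
    have hcont : ContinuousAt (fun p : ℝ =>
        4 * p * (1 - p) * ((1 + R) / (1 - R)) ^ 2 * Real.exp (η / x₀) ^ 2) P := by fun_prop
    have hgt : 1 < 4 * P * (1 - P) * ((1 + R) / (1 - R)) ^ 2 * Real.exp (η / x₀) ^ 2 := by
      rw [hPone, one_mul]
      exact one_lt_pow₀ (Real.one_lt_exp_iff.2 (div_pos hη0 (by linarith))) two_ne_zero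
    obtain ⟨p, hp, hp0, hpP⟩ := (((hcont.eventually_const_lt hgt).filter_mono
      nhdsWithin_le_nhds).and (Ioo_mem_nhdsLT hP0)).exists
    have := mlThreshold_le hp0 (exists_le_mlErrorProb_cycleCodes hR0 hp0 (hpP.trans hP1)
      (by linarith) hη (by rw [hgr]; exact hp))
    linarith
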